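/- **Theorem (average speed of grid peeling for parabolas).** For a convex function $C:\mathbb R\to\mathbb R$ (identified with its graph), let $U_0$ be the set of points of $\mathbb Z^2$ on or above $C$, and let $U_{m+1}$ be obtained from $U_m$ by removing all vertices (extreme points) of the convex hull of $U_m$. Let $f^{(m)}(C)$ be the lower boundary of the convex hull of $U_m$, i.e. the curve after $m$ steps of grid peeling. For two curves write $C\le D$ if no point of $C$ lies above $D$, and let $C+\gamma$ be $C$ translated vertically by $\gamma\in\mathbb R$. The lower and upper average (vertical) speeds of $C$ are $$v_-(C)=\liminf_{m\to\infty}\frac{\sup\{\gamma\mid C+\gamma\le f^{(m)}(C)\}}{m},\qquad v_+(C)=\limsup_{m\to\infty}\frac{\inf\{\gamma\mid f^{(m)}(C)\le C+\gamma\}}{m}$$ (in the extended reals); if they coincide, their common value is the average speed $v(C)$. For $t\ge 1$ let $$H_t=\sum_{\substack{0<y\le x\le t\\ \gcd(x,y)=1}}\left\lfloor\frac tx\right\rfloor x\qquad(H_1,H_2,H_3,\ldots=1,4,11,22,43,\ldots).$$ Let $a,b,c\in\mathbb R$, and let $v_-$, $v_+$ (and $v$, if it exists) be the average speeds of the parabola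 $y=ax^2/2+bx+c$. 1. If $a>1/H_1=1$, then $v$ exists and $v=1$. If $t\ge 3$ is odd and $\frac1{H_t}<a<\frac1{H_{t-1}}$, then $v$ exists and $v=\frac1t$. 2. If $t\ge 2$ is even and $\frac1{H_t}<a<\frac1{H_{t-1}}$, then $\frac1{t+1}\le v_-\le v_+\le\frac1{t-1}$. 3. If $t\ge1$ is odd and $a=\frac1{H_t}$, then $\frac1{t+2}\le v_-\le v_+\le\frac1t$. 4. If $t\ge2$ is even and $a=\frac1{H_t}$, then $\frac1{t+1}\le v_-\le v_+\le\frac1{t-1}$. -/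

import Mathlib

namespace GridPeeling

open Filter

/-- The set of primitive directions `(x, y)` with `0 < y ≤ x ≤ t` and `gcd x y = 1`, that is, the
reduced slopes `y / x` in the interval `(0, 1]` with denominator at most `t`. -/
def primitiveVectors (t : ℕ) : Finset (ℕ × ℕ) :=
  (Finset.Icc 1 t ×ˢ Finset.Icc 1 t).filter fun p => p.2 ≤ p.1 ∧ Nat.Coprime p.1 p.2

/-- The horizontal period `H_t = ∑ ⌊t / x⌋ * x`, the sum being over the primitive directions
`(x, y)` with `0 < y ≤ x ≤ t`: each direction contributes the horizontal extent of its longest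
integer multiple whose horizontal extent is at most `t`. (Division is division of naturals,
i.e. the floor.) -/
def horizontalPeriod (t : ℕ) : ℕ :=
  ∑ p ∈ primitiveVectors t, (t / p.1) * p.1

/-- The inclusion of the unit grid into the plane. -/
def gridToPlane (p : ℤ × ℤ) : ℝ × ℝ := ((p.1 : ℝ), (p.2 : ℝ))

/-- The convex hull in the plane of a set of grid points. -/
def hull (U : Set (ℤ × ℤ)) : Set (ℝ × ℝ) := convexHull ℝ (gridToPlane '' U)

/-- One step of grid peeling: remove all vertices (extreme points) of the convex hull. -/
def peel (U : Set (ℤ × ℤ)) : Set (ℤ × ℤ) :=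
  {p | p ∈ U ∧ gridToPlane p ∉ (hull U).extremePoints ℝ}

/-- The grid points on or above the graph of `C`. -/
def gridPointsAbove (C : ℝ → ℝ) : Set (ℤ × ℤ) := {p | C (p.1 : ℝ) ≤ (p.2 : ℝ)}

/-- The lower boundary of the convex hull of a set of grid points, as a function of the
abscissa (the value is `⊤` at abscissas that the hull does not meet). -/
noncomputable def lowerBoundary (U : Set (ℤ × ℤ)) (x : ℝ) : EReal :=
  sInf {z : EReal | ∃ y : ℝ, (x, y) ∈ hull U ∧ z = (y : EReal)}

/-- The curve obtained from the graph of `C` after `m` steps of grid peeling: start with the grid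
points on or above `C`, remove `m` times the vertices of the convex hull, and take the (lower)
boundary of the convex hull of what remains. -/
noncomputable def peeledCurve (C : ℝ → ℝ) (m : ℕ) : ℝ → EReal :=
  lowerBoundary (peel^[m] (gridPointsAbove C))

/-- The largest vertical shift for which the graph of `C` stays below the `m`-th peeled curve:
`sup {γ | C + γ ≤ f^(m)(C)}`. -/
noncomputable def lowerAdvance (C : ℝ → ℝ) (m : ℕ) : EReal :=
  sSup {z : EReal | ∃ γ : ℝ, (∀ x : ℝ, ((C x + γ : ℝ) : EReal) ≤ peeledCurve C m x) ∧
    z = (γ : EReal)}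

/-- The smallest vertical shift for which the graph of `C` stays above the `m`-th peeled curve:
`inf {γ | f^(m)(C) ≤ C + γ}`. -/
noncomputable def upperAdvance (C : ℝ → ℝ) (m : ℕ) : EReal :=
  sInf {z : EReal | ∃ γ : ℝ, (∀ x : ℝ, peeledCurve C m x ≤ ((C x + γ : ℝ) : EReal)) ∧
    z = (γ : EReal)}

/-- The lower average (vertical) speed `v_-` of grid peeling for the graph of `C`. -/
noncomputable def lowerSpeed (C : ℝ → ℝ) : EReal :=
  liminf (fun m : ℕ => lowerAdvance C m / (m : EReal)) atTop

/-- The upper average (vertical) speed `v_+` of grid peeling for the graph of `C`. -/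
noncomputable def upperSpeed (C : ℝ → ℝ) : EReal :=
  limsup (fun m : ℕ => upperAdvance C m / (m : EReal)) atTop

/-- The average speed of `C` exists and is `v`: the lower and the upper average speed are both
equal to `v`. -/
def HasAverageSpeed (C : ℝ → ℝ) (v : ℝ) : Prop :=
  lowerSpeed C = (v : EReal) ∧ upperSpeed C = (v : EReal)

/-- `l ≤ v_- ≤ v_+ ≤ u` for the lower and upper average speeds of `C`. -/
def SpeedsBetween (C : ℝ → ℝ) (l u : ℝ) : Prop :=
  (l : EReal) ≤ lowerSpeed C ∧ lowerSpeed C ≤ upperSpeed C ∧ upperSpeed C ≤ (u : EReal)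

/-- The function whose graph is the parabola `y = a x² / 2 + b x + c`. -/
noncomputable def parabola (a b c : ℝ) (x : ℝ) : ℝ := a * x ^ 2 / 2 + b * x + c

end GridPeeling

/-! Peeling is monotone under inclusion (`peel_mono`), so a parabola can be compared with polygonal
chains whose motion is known exactly. Fix an odd order t = 2s + 1 and take all reduced slopes with
denominator at most t. A chain uses them in increasing order, the direction (x, y) with multiplicity
w(x). Consecutive directions have determinant 1, so moving an edge to its next grid line shifts each
endpoint by a neighbouring direction.

Let a vertex decide from its horizontal displacement alone which adjacent edges advance. The
displacement then permutes the window [-s, s] cyclically, and after t steps the vertex has moved by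
exactly (0, 1) (`vertexStep_period`, `vertex_period`). The two ends of an edge always agree
(`advances_iff`), so the chain keeps its directions and has speed 1/t.

With w = ⌊t/x⌋, an advancing edge has length at most one, so all its grid points are vertices and
peeling is at least as fast as this motion (`peel_region_subset`). With w = ⌊(t-1)/x⌋, lengths stay
nonnegative and each vertex lies on an advancing edge, so peeling is at most as fast
(`region_succ_subset_peel`).

While the slope grows by one, these chains cover horizontal extents H_t and H_{t-1}, so they follow
parabolas of curvature 1/H_t and 1/H_{t-1} up to bounded error. If a > 1/H_t, a chain of the first
kind fits below the parabola within bounded distance of any prescribed point; if a < 1/H_{t-1}, one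
of the second kind fits above (`exists_parabola_le_peeled`, `exists_mem_peeled_le_parabola`).
Bounded errors vanish on division by m. Even t and critical a are bracketed by odd orders, as H_t is
strictly increasing. -/

namespace GridPeeling

/-! ### Motion of a single vertex in its window -/

/-- The determinant of two integer vectors. For a primitive direction `d`, the function `det d` is
constant on the grid lines of direction `d`, and it increases upwards if `0 < d.1`. -/
def det (p q : ℤ × ℤ) : ℤ := p.1 * q.2 - p.2 * q.1

/-- The motion of a vertex of the chain within the window `[-s, s]` of abscissas relative to its
initial position: the left edge, of horizontal extent `x`, advances if `δ < x - s`, and the right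
edge, of horizontal extent `x'`, advances if `s - x' < δ`. -/
def vertexStep (s x x' δ : ℤ) : ℤ :=
  δ + (if δ < x - s then x' else 0) - (if s - x' < δ then x else 0)

theorem vertexStep_mem {s x x' δ : ℤ} (hxs : x ≤ 2 * s + 1)
    (hxs' : x' ≤ 2 * s + 1) (h : 2 * s + 1 < x + x') (hδ : δ ∈ Set.Icc (-s) s) :
    vertexStep s x x' δ ∈ Set.Icc (-s) s := by
  obtain ⟨h1, h2⟩ := hδ
  unfold vertexStep
  constructor <;> split_ifs <;> omega

/-- The step exchanges three intervals: left edge only, both edges, and right edge only are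
translated onto [x' - s, s], (s - x, x' - s) and [-s, s - x], which are disjoint. -/
theorem vertexStep_injOn {s x x' : ℤ} (h : 2 * s + 1 < x + x') :
    Set.InjOn (vertexStep s x x') (Set.Icc (-s) s) := by
  rintro a ⟨h1, h2⟩ b ⟨h3, h4⟩ hab
  unfold vertexStep at hab
  split_ifs at hab <;> omega

theorem vertexStep_iterate_mem {s x x' δ : ℤ} (hxs : x ≤ 2 * s + 1)
    (hxs' : x' ≤ 2 * s + 1) (h : 2 * s + 1 < x + x') (hδ : δ ∈ Set.Icc (-s) s) (m : ℕ) :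
    (vertexStep s x x')^[m] δ ∈ Set.Icc (-s) s := by
  induction m with
  | zero => exact hδ
  | succ m ih =>
    rw [Function.iterate_succ_apply']
    exact vertexStep_mem hxs hxs' h ih

/-- The number of steps among the first `m` at which the left edge advances. -/
def leftCount (s x x' δ : ℤ) (m : ℕ) : ℕ :=
  ((Finset.range m).filter fun k => (vertexStep s x x')^[k] δ < x - s).card

/-- The number of steps among the first `m` at which the right edge advances. -/
def rightCount (s x x' δ : ℤ) (m : ℕ) : ℕ :=
  ((Finset.range m).filter fun k => s - x' < (vertexStep s x x')^[k] δ).card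

theorem leftCount_succ (s x x' δ : ℤ) (m : ℕ) : leftCount s x x' δ (m + 1) =
    leftCount s x x' δ m + if (vertexStep s x x')^[m] δ < x - s then 1 else 0 := by
  unfold leftCount
  rw [Finset.range_add_one, Finset.filter_insert]
  split_ifs
  · rw [Finset.card_insert_of_notMem (by simp)]
  · rfl

theorem rightCount_succ (s x x' δ : ℤ) (m : ℕ) : rightCount s x x' δ (m + 1) =
    rightCount s x x' δ m + if s - x' < (vertexStep s x x')^[m] δ then 1 else 0 := by
  unfold rightCount
  rw [Finset.range_add_one, Finset.filter_insert]
  split_ifs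
  · rw [Finset.card_insert_of_notMem (by simp)]
  · rfl

theorem vertexStep_iterate (s x x' δ : ℤ) (m : ℕ) : (vertexStep s x x')^[m] δ =
    δ + leftCount s x x' δ m * x' - rightCount s x x' δ m * x := by
  induction m with
  | zero => simp [leftCount, rightCount]
  | succ m ih =>
    rw [Function.iterate_succ_apply', leftCount_succ, rightCount_succ]
    rw [vertexStep]
    push_cast
    split_ifs <;> linarith

/-- The motion of a vertex is a cyclic permutation of the window. -/
theorem vertexStep_period {s x x' δ : ℤ} (hs : 0 ≤ s) (hx : 0 < x) (hx' : 0 < x')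
    (hxs : x ≤ 2 * s + 1) (hxs' : x' ≤ 2 * s + 1) (h : 2 * s + 1 < x + x') (hc : IsCoprime x x')
    (hδ : δ ∈ Set.Icc (-s) s) :
    (leftCount s x x' δ (2 * s + 1).toNat : ℤ) = x ∧
      (rightCount s x x' δ (2 * s + 1).toNat : ℤ) = x' := by
  set f := vertexStep s x x' with hf
  have hmaps : ∀ m, f^[m] δ ∈ Set.Icc (-s) s :=
    vertexStep_iterate_mem hxs hxs' h hδ
  have hper : δ ∈ Function.periodicPts f := by
    have hM : Set.MapsTo f (Set.Icc (-s) s) (Set.Icc (-s) s) :=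
      fun a ha => vertexStep_mem hxs hxs' h ha
    have hinj : Function.Injective (hM.restrict f _ _) :=
      (hM.restrict_inj).2 (vertexStep_injOn h)
    have hp := hinj.mem_periodicPts ⟨δ, hδ⟩
    obtain ⟨n, hn, hp⟩ := hp
    refine ⟨n, hn, ?_⟩
    have := congrArg Subtype.val hp
    rw [hM.iterate_restrict] at this
    exact this
  set l := Function.minimalPeriod f δ with hl
  have hlpos : 0 < l := Function.minimalPeriod_pos_of_mem_periodicPts hper
  have hinjl : Set.InjOn (fun k => f^[k] δ) (Set.Iio l) := Function.iterate_injOn_Iio_minimalPeriod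
  have hret : f^[l] δ = δ := Function.iterate_minimalPeriod
  -- Positions within one minimal period are distinct, so steps can be counted by window positions.
  have bound : ∀ (P : ℤ → Prop) [DecidablePred P] (A : Finset ℤ),
      (∀ z ∈ Set.Icc (-s) s, P z → z ∈ A) →
      ((Finset.range l).filter fun k => P (f^[k] δ)).card ≤ A.card := by
    intro P _ A hA
    refine Finset.card_le_card_of_injOn (fun k => f^[k] δ) ?_ ?_
    · intro k hk
      exact hA _ (hmaps k) (Finset.mem_filter.1 hk).2
    · intro k hk k' hk' e
      exact hinjl (Finset.mem_range.1 (Finset.mem_filter.1 hk).1)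
        (Finset.mem_range.1 (Finset.mem_filter.1 hk').1) e
  have hL : leftCount s x x' δ l ≤ (Finset.Ico (-s) (x - s)).card :=
    bound (fun z => z < x - s) _ (fun z hz hz' => Finset.mem_Ico.2 ⟨hz.1, hz'⟩)
  have hR : rightCount s x x' δ l ≤ (Finset.Ioc (s - x') s).card :=
    bound (fun z => s - x' < z) _ (fun z hz hz' => Finset.mem_Ioc.2 ⟨hz', hz.2⟩)
  have hB : ((Finset.range l).filter
      fun k => f^[k] δ < x - s ∧ s - x' < f^[k] δ).card ≤ (Finset.Ioo (s - x') (x - s)).card :=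
    bound (fun z => z < x - s ∧ s - x' < z) _ (fun z hz hz' => Finset.mem_Ioo.2 ⟨hz'.2, hz'.1⟩)
  have hT : ((Finset.range l).filter fun k => True).card ≤ (Finset.Icc (-s) s).card :=
    bound (fun _ => True) _ (fun z hz _ => Finset.mem_Icc.2 hz)
  have hsum : leftCount s x x' δ l + rightCount s x x' δ l = l + ((Finset.range l).filter
      fun k => f^[k] δ < x - s ∧ s - x' < f^[k] δ).card := by
    unfold leftCount rightCount
    rw [← Finset.card_union_add_card_inter, ← Finset.filter_or, ← Finset.filter_and]
    congr 1
    rw [Finset.filter_true_of_mem, Finset.card_range]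
    intro k _
    omega
  -- A closed orbit has zero displacement: L x' = R x for the counts L, R of left and right
  -- advances. Coprimality gives x ∣ L, and L ≤ x. If L = 0 then R = 0, impossible because some edge
  -- advances at every step. Hence L = x and R = x'.
  have hdisp := vertexStep_iterate s x x' δ l
  rw [← hf, hret] at hdisp
  simp only [Int.card_Ico, Int.card_Ioc, Int.card_Ioo, Int.card_Icc, Finset.filter_true,
    Finset.card_range] at hL hR hB hT
  have hdvd : x ∣ (leftCount s x x' δ l : ℤ) :=
    hc.dvd_of_dvd_mul_right ⟨rightCount s x x' δ l, by linarith⟩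
  have hLx : (leftCount s x x' δ l : ℤ) = x := by
    obtain ⟨c, hcx⟩ := hdvd
    have h1 : x * c ≤ x := by omega
    have h2 : c ≤ 1 := by nlinarith
    have h3 : 0 ≤ c := by
      by_contra hneg
      push Not at hneg
      have : x * c < 0 := by nlinarith
      omega
    have h4 : c ≠ 0 := by
      rintro rfl
      have h5 : (leftCount s x x' δ l : ℤ) = 0 := by simpa using hcx
      rw [h5] at hdisp
      have h6 : (rightCount s x x' δ l : ℤ) * x = 0 := by linarith
      rcases mul_eq_zero.1 h6 with h7 | h7 <;> omega
    have h5 : c = 1 := by omega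
    rw [hcx, h5, mul_one]
  have hRx : (rightCount s x x' δ l : ℤ) = x' := by
    rw [hLx] at hdisp
    have : (rightCount s x x' δ l : ℤ) * x = x' * x := by linarith
    exact mul_right_cancel₀ hx.ne' this
  -- Both edges advance at no more than x + x' - (2s + 1) positions, so the orbit has at least 2s +
  -- 1 elements and fills the window.
  have hlt : l = (2 * s + 1).toNat := by omega
  rw [← hlt]
  exact ⟨hLx, hRx⟩

/-! ### Farey sequences and the moving chain -/

theorem det_add_right (d p q : ℤ × ℤ) : det d (p + q) = det d p + det d q := by
  simp only [det, Prod.fst_add, Prod.snd_add]; ring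

theorem det_sub_right (d p q : ℤ × ℤ) : det d (p - q) = det d p - det d q := by
  simp only [det, Prod.fst_sub, Prod.snd_sub]; ring

theorem det_smul_right (d p : ℤ × ℤ) (a : ℤ) : det d (a • p) = a * det d p := by
  simp only [det, Prod.smul_fst, Prod.smul_snd, smul_eq_mul]; ring

theorem det_self (d : ℤ × ℤ) : det d d = 0 := by simp only [det]; ring

theorem det_swap (d e : ℤ × ℤ) : det e d = - det d e := by simp only [det]; ring

/-- Plücker relation for a unimodular pair. -/
theorem eq_smul_sub_smul {d e : ℤ × ℤ} (h : det d e = 1) (v : ℤ × ℤ) :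
    v = det d v • e - det e v • d := by
  unfold det at *
  ext
  · simp only [Prod.fst_sub, Prod.smul_fst, smul_eq_mul]; linear_combination (-v.1) * h
  · simp only [Prod.snd_sub, Prod.smul_snd, smul_eq_mul]; linear_combination (-v.2) * h

/-- A bi-infinite sequence of directions of increasing slope with the properties of the sequence of
all reduced fractions with denominator at most `t`. -/
structure FareySequence (t : ℤ) where
  /-- The directions in the order of their slopes. -/
  dir : ℤ → ℤ × ℤ
  det_succ : ∀ i, det (dir i) (dir (i + 1)) = 1
  pos : ∀ i, 0 < (dir i).1
  le : ∀ i, (dir i).1 ≤ t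
  lt_add : ∀ i, t < (dir i).1 + (dir (i + 1)).1

namespace FareySequence

theorem det_nonneg {t : ℤ} (e : FareySequence t) {i j : ℤ} (hij : i ≤ j) :
    0 ≤ det (e.dir i) (e.dir j) := by
  have hmono : StrictMono fun i => ((e.dir i).2 : ℚ) / (e.dir i).1 := by
    refine strictMono_int_of_lt_succ fun i => ?_
    have h1 : (0 : ℚ) < (e.dir i).1 := by exact_mod_cast e.pos i
    have h2 : (0 : ℚ) < (e.dir (i + 1)).1 := by exact_mod_cast e.pos (i + 1)
    have h3 : ((e.dir i).1 : ℚ) * (e.dir (i + 1)).2 - (e.dir i).2 * (e.dir (i + 1)).1 = 1 := by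
      exact_mod_cast e.det_succ i
    show ((e.dir i).2 : ℚ) / (e.dir i).1 < _ / _
    rw [div_lt_div_iff₀ h1 h2]
    linarith
  have h := hmono.monotone hij
  have h1 : (0 : ℚ) < (e.dir i).1 := by exact_mod_cast e.pos i
  have h2 : (0 : ℚ) < (e.dir j).1 := by exact_mod_cast e.pos j
  change ((e.dir i).2 : ℚ) / (e.dir i).1 ≤ _ / _ at h
  rw [div_le_div_iff₀ h1 h2] at h
  have h' : (e.dir i).2 * (e.dir j).1 ≤ (e.dir j).2 * (e.dir i).1 := by exact_mod_cast h
  unfold det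
  linarith

/-- When an edge advances, its ends move by `-e.dir i` and `e.dir (i + 2)`. Their difference is a
multiple of the edge's own direction, so the edge stays parallel to itself. -/
theorem dir_add_dir {t : ℤ} (e : FareySequence t) (i : ℤ) :
    e.dir i + e.dir (i + 1 + 1) = det (e.dir i) (e.dir (i + 1 + 1)) • e.dir (i + 1) := by
  have h := eq_smul_sub_smul (e.det_succ i) (e.dir (i + 1 + 1))
  rw [e.det_succ (i + 1), one_smul] at h
  rw [add_comm]
  exact eq_sub_iff_add_eq.1 h

theorem isCoprime {t : ℤ} (e : FareySequence t) (i : ℤ) :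
    IsCoprime (e.dir i).1 (e.dir (i + 1)).1 := by
  have h := e.det_succ i
  unfold det at h
  exact ⟨(e.dir (i + 1)).2, -(e.dir i).2, by linarith⟩

/-- The vertices after `m` steps of the motion that starts with the vertices `Q i`, where the
vertex `i` lies between the edges of directions `e.dir i` and `e.dir (i + 1)`. -/
def vertex {t : ℤ} (e : FareySequence t) (s : ℤ) (Q : ℤ → ℤ × ℤ) : ℕ → ℤ → ℤ × ℤ
  | 0, i => Q i
  | m + 1, i => vertex e s Q m i
      + (if (vertex e s Q m i).1 - (Q i).1 < (e.dir i).1 - s then 1 else 0 : ℤ) • e.dir (i + 1)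
      - (if s - (e.dir (i + 1)).1 < (vertex e s Q m i).1 - (Q i).1 then 1 else 0 : ℤ) • e.dir i

variable {s : ℤ} (e : FareySequence (2 * s + 1)) (Q : ℤ → ℤ × ℤ)

theorem vertex_sub (m : ℕ) (i : ℤ) : (e.vertex s Q m i).1 - (Q i).1 =
    (vertexStep s (e.dir i).1 (e.dir (i + 1)).1)^[m] 0 := by
  induction m with
  | zero => simp [vertex]
  | succ m ih =>
    rw [Function.iterate_succ_apply', ← ih, vertex, vertexStep]
    simp only [Prod.fst_sub, Prod.fst_add, Prod.smul_fst, smul_eq_mul, ite_mul, one_mul, zero_mul]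
    ring

theorem vertex_sub_mem (hs : 0 ≤ s) (m : ℕ) (i : ℤ) :
    (e.vertex s Q m i).1 - (Q i).1 ∈ Set.Icc (-s) s := by
  rw [vertex_sub]
  exact vertexStep_iterate_mem (e.le i) (e.le _) (e.lt_add i) ⟨by omega, hs⟩ m

theorem vertex_eq (m : ℕ) (i : ℤ) : e.vertex s Q m i = Q i +
    (leftCount s (e.dir i).1 (e.dir (i + 1)).1 0 m : ℤ) • e.dir (i + 1) -
    (rightCount s (e.dir i).1 (e.dir (i + 1)).1 0 m : ℤ) • e.dir i := by
  induction m with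
  | zero => simp [vertex, leftCount, rightCount]
  | succ m ih =>
    rw [vertex, vertex_sub, leftCount_succ, rightCount_succ, ih]
    push_cast
    simp only [add_smul]
    abel

theorem vertex_period (hs : 0 ≤ s) (i : ℤ) :
    e.vertex s Q (2 * s + 1).toNat i = Q i + (0, 1) := by
  obtain ⟨h1, h2⟩ := vertexStep_period hs (e.pos i) (e.pos (i + 1)) (e.le i) (e.le _) (e.lt_add i)
    (e.isCoprime i) (δ := 0) ⟨by omega, hs⟩
  -- The total move is x • (x', y') - x' • (x, y) = (0, det) = (0, 1).
  rw [vertex_eq, h1, h2, add_sub_assoc]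
  congr 1
  have := e.det_succ i
  unfold det at this
  ext
  · simp only [Prod.fst_sub, Prod.smul_fst, smul_eq_mul]; ring
  · simp only [Prod.snd_sub, Prod.smul_snd, smul_eq_mul]; linarith

theorem vertex_add_period (hs : 0 ≤ s) (m : ℕ) (i : ℤ) :
    e.vertex s Q (m + (2 * s + 1).toNat) i = e.vertex s Q m i + (0, 1) := by
  induction m with
  | zero => rw [Nat.zero_add, vertex_period e Q hs, vertex]
  | succ m ih =>
    rw [Nat.add_right_comm, vertex, ih, vertex]
    simp only [Prod.fst_add, add_zero]
    abel

theorem vertex_mul_period (hs : 0 ≤ s) (k : ℕ) (i : ℤ) :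
    e.vertex s Q (k * (2 * s + 1).toNat) i = Q i + (0, (k : ℤ)) := by
  induction k with
  | zero => simp [vertex]
  | succ k ih =>
    rw [Nat.add_mul, one_mul, vertex_add_period e Q hs, ih, add_assoc]
    simp

/-- The edge of direction `e.dir i` advances at step `m`. -/
def Advances (m : ℕ) (i : ℤ) : Prop := (e.vertex s Q m i).1 - (Q i).1 < (e.dir i).1 - s

/-- At each vertex, at least one of the two adjacent edges advances. -/
theorem advances_or (m : ℕ) (i : ℤ) : e.Advances Q m i ∨
    s - (e.dir (i + 1)).1 < (e.vertex s Q m i).1 - (Q i).1 := by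
  have := e.lt_add i
  unfold Advances
  omega

/-- Both sides are equivalent to b + j ≤ 0. Here d₀ and d₁ are the displacements of the left and
right end of an edge of extent x. -/
theorem advances_iff_aux {x d₀ d₁ b j : ℤ} (hx : 0 < x) (hb : d₁ - d₀ = b * x)
    (h1 : s - x < d₁ + j * x) (h3 : d₀ - j * x < x - s) (h2 : d₁ + j * x ≤ s)
    (h4 : -s ≤ d₀ - j * x) : d₁ < x - s ↔ s - x < d₀ := by
  by_cases h : b + j ≤ 0
  · have : (b + j) * x ≤ 0 := mul_nonpos_of_nonpos_of_nonneg h hx.le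
    constructor <;> intro <;> nlinarith
  · have : 0 ≤ (b + j - 1) * x := mul_nonneg (by omega) hx.le
    constructor <;> intro <;> nlinarith

theorem vertex_succ (m : ℕ) (i : ℤ) : e.vertex s Q (m + 1) i = e.vertex s Q m i
    + (if (e.vertex s Q m i).1 - (Q i).1 < (e.dir i).1 - s then 1 else 0 : ℤ) • e.dir (i + 1)
    - (if s - (e.dir (i + 1)).1 < (e.vertex s Q m i).1 - (Q i).1 then 1 else 0 : ℤ) • e.dir i :=
  rfl

/-- Both endpoints of an edge remain equally far from the respective extreme grid points that the
edge had when it appeared on its present line. -/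
theorem edge_invariant (hs : 0 ≤ s) {w : ℤ → ℤ}
    (hQ : ∀ i, Q (i + 1) = Q i + w (i + 1) • e.dir (i + 1)) (m : ℕ) (i : ℤ) :
    ∃ a j : ℤ, e.vertex s Q m (i + 1) = e.vertex s Q m i + a • e.dir (i + 1) ∧
      s - (e.dir (i + 1)).1 <
        (e.vertex s Q m (i + 1)).1 - (Q (i + 1)).1 + j * (e.dir (i + 1)).1 ∧
      (e.vertex s Q m (i + 1)).1 - (Q (i + 1)).1 + j * (e.dir (i + 1)).1 ≤ s ∧
      (e.vertex s Q m i).1 - (Q i).1 - j * (e.dir (i + 1)).1 < (e.dir (i + 1)).1 - s ∧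
      -s ≤ (e.vertex s Q m i).1 - (Q i).1 - j * (e.dir (i + 1)).1 := by
  induction m with
  | zero =>
    have hx := e.pos (i + 1)
    have h1 := Int.emod_nonneg s hx.ne'
    have h2 := Int.emod_lt_of_pos s hx
    have h3 := Int.emod_add_ediv_mul s (e.dir (i + 1)).1
    -- The symmetric window makes this j work for both ends, which start at displacement 0.
    refine ⟨w (i + 1), s / (e.dir (i + 1)).1, hQ i, ?_⟩
    simp only [vertex, sub_self]
    omega
  | succ m ih =>
    obtain ⟨a, j, ha, h1, h2, h3, h4⟩ := ih
    have hx := e.pos (i + 1)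
    have hb : ((e.vertex s Q m (i + 1)).1 - (Q (i + 1)).1) - ((e.vertex s Q m i).1 - (Q i).1) =
        (a - w (i + 1)) * (e.dir (i + 1)).1 := by
      rw [ha, hQ i]
      simp only [Prod.fst_add, Prod.smul_fst, smul_eq_mul]
      ring
    have hF := advances_iff_aux hx hb h1 h3 h2 h4
    have hle := e.le (i + 1 + 1)
    have hle' := e.le i
    have hadd := e.lt_add i
    have hadd' := e.lt_add (i + 1)
    obtain ⟨hw1, hw2⟩ := e.vertex_sub_mem Q hs m (i + 1)
    obtain ⟨hw3, hw4⟩ := e.vertex_sub_mem Q hs m i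
    by_cases h : (e.vertex s Q m (i + 1)).1 - (Q (i + 1)).1 < (e.dir (i + 1)).1 - s
    · have h' := hF.1 h
      -- The advance changes the length by the determinant of the two neighbouring directions; each
      -- neighbour that advances too cuts off one unit. On the new line j restarts at 0.
      refine ⟨a + det (e.dir i) (e.dir (i + 1 + 1))
        - (if s - (e.dir (i + 1 + 1)).1 < (e.vertex s Q m (i + 1)).1 - (Q (i + 1)).1
          then 1 else 0)
        - (if (e.vertex s Q m i).1 - (Q i).1 < (e.dir i).1 - s then 1 else 0), 0, ?_, ?_⟩
      · rw [vertex_succ, vertex_succ, if_pos h, if_pos h', ha]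
        simp only [sub_smul, add_smul, one_smul]
        rw [← e.dir_add_dir i]
        abel
      · rw [vertex_succ, vertex_succ, if_pos h, if_pos h']
        simp only [Prod.fst_sub, Prod.fst_add, Prod.smul_fst, smul_eq_mul, ite_mul, one_mul,
          zero_mul, add_zero, sub_zero]
        split_ifs <;> omega
    · have h' := mt hF.2 h
      have h5 : s - (e.dir (i + 1 + 1)).1 < (e.vertex s Q m (i + 1)).1 - (Q (i + 1)).1 := by
        omega
      have h6 : (e.vertex s Q m i).1 - (Q i).1 < (e.dir i).1 - s := by omega
      -- A resting edge has two advancing neighbours and loses one unit at each end.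
      refine ⟨a - 2, j + 1, ?_, ?_⟩
      · rw [vertex_succ, vertex_succ, if_neg h, if_neg h', if_pos h5, if_pos h6, ha]
        simp only [sub_smul, zero_smul, one_smul, two_smul]
        abel
      · rw [vertex_succ, vertex_succ, if_neg h, if_neg h', if_pos h5, if_pos h6]
        simp only [Prod.fst_sub, Prod.fst_add, Prod.smul_fst, smul_eq_mul, one_mul,
          zero_mul, add_zero, sub_zero, add_mul]
        omega

/-- The two endpoints of an edge agree on whether it advances. -/
theorem advances_iff (hs : 0 ≤ s) {w : ℤ → ℤ}
    (hQ : ∀ i, Q (i + 1) = Q i + w (i + 1) • e.dir (i + 1)) (m : ℕ) (i : ℤ) :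
    e.Advances Q m (i + 1) ↔ s - (e.dir (i + 1)).1 < (e.vertex s Q m i).1 - (Q i).1 := by
  obtain ⟨a, j, ha, h1, h2, h3, h4⟩ := e.edge_invariant Q hs hQ m i
  refine advances_iff_aux (e.pos (i + 1)) (b := a - w (i + 1)) ?_ h1 h3 h2 h4
  rw [ha, hQ i]
  simp only [Prod.fst_add, Prod.smul_fst, smul_eq_mul]
  ring

/-- The length of an edge is nonnegative if the initial lengths are large enough, and an edge that
advances has length at most one if the initial lengths are small enough. -/
theorem exists_length (hs : 0 ≤ s) {w : ℤ → ℤ}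
    (hQ : ∀ i, Q (i + 1) = Q i + w (i + 1) • e.dir (i + 1)) (m : ℕ) (i : ℤ) :
    ∃ a : ℤ, e.vertex s Q m (i + 1) = e.vertex s Q m i + a • e.dir (i + 1) ∧
      (2 * s < (w (i + 1) + 1) * (e.dir (i + 1)).1 → 0 ≤ a) ∧
      (w (i + 1) * (e.dir (i + 1)).1 ≤ 2 * s + 1 → e.Advances Q m (i + 1) → a ≤ 1) := by
  obtain ⟨a, j, ha, -⟩ := e.edge_invariant Q hs hQ m i
  have hx := e.pos (i + 1)
  have hb : ((e.vertex s Q m (i + 1)).1 - (Q (i + 1)).1) - ((e.vertex s Q m i).1 - (Q i).1) =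
      (a - w (i + 1)) * (e.dir (i + 1)).1 := by
    rw [ha, hQ i]
    simp only [Prod.fst_add, Prod.smul_fst, smul_eq_mul]
    ring
  refine ⟨a, ha, fun h => ?_, fun h hA => ?_⟩
  · obtain ⟨hw1, hw2⟩ := e.vertex_sub_mem Q hs m (i + 1)
    obtain ⟨hw3, hw4⟩ := e.vertex_sub_mem Q hs m i
    have : 0 < (a + 1) * (e.dir (i + 1)).1 := by nlinarith
    have := (mul_pos_iff_of_pos_right hx).1 this
    omega
  · have h' := (e.advances_iff Q hs hQ m i).1 hA
    unfold Advances at hA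
    by_contra h2
    have : 2 * (e.dir (i + 1)).1 ≤ a * (e.dir (i + 1)).1 :=
      mul_le_mul_of_nonneg_right (by omega) hx.le
    nlinarith

end FareySequence
-- Monotonicity of peeling, and chains with short edges
theorem hull_mono {U V : Set (ℤ × ℤ)} (h : U ⊆ V) : hull U ⊆ hull V :=
  convexHull_mono (Set.image_mono h)

theorem gridToPlane_mem_hull {U : Set (ℤ × ℤ)} {p : ℤ × ℤ} (hp : p ∈ U) :
    gridToPlane p ∈ hull U :=
  subset_convexHull ℝ _ (Set.mem_image_of_mem _ hp)

theorem peel_subset (U : Set (ℤ × ℤ)) : peel U ⊆ U := fun _ hp => hp.1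

/-- A point of the smaller hull that is extreme in the larger hull is extreme in the smaller one. -/
theorem peel_mono {U V : Set (ℤ × ℤ)} (h : U ⊆ V) : peel U ⊆ peel V := by
  rintro p ⟨hp, hpe⟩
  refine ⟨h hp, fun hV => hpe ?_⟩
  exact inter_extremePoints_subset_extremePoints_of_subset (hull_mono h)
    ⟨gridToPlane_mem_hull hp, hV⟩

theorem peel_iterate_mono (m : ℕ) {U V : Set (ℤ × ℤ)} (h : U ⊆ V) :
    peel^[m] U ⊆ peel^[m] V := by
  induction m with
  | zero => exact h
  | succ m ih => rw [Function.iterate_succ_apply', Function.iterate_succ_apply']; exact peel_mono ih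

theorem peel_iterate_antitone (U : Set (ℤ × ℤ)) : Antitone fun m => peel^[m] U := by
  refine antitone_nat_of_succ_le fun m => ?_
  show peel^[m + 1] U ⊆ peel^[m] U
  rw [Function.iterate_succ_apply']
  exact peel_subset _

theorem le_of_mem_hull {U : Set (ℤ × ℤ)} {d : ℤ × ℤ} {c : ℤ} (h : ∀ p ∈ U, c ≤ det d p)
    {z : ℝ × ℝ} (hz : z ∈ hull U) : (c : ℝ) ≤ d.1 * z.2 - d.2 * z.1 := by
  have hconv : Convex ℝ {z : ℝ × ℝ | (c : ℝ) ≤ d.1 * z.2 - d.2 * z.1} := by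
    intro x hx y hy α β hα hβ hαβ
    simp only [Set.mem_ofPred_eq, Prod.fst_add, Prod.snd_add, Prod.smul_fst, Prod.smul_snd,
      smul_eq_mul] at *
    have : (c : ℝ) = α * c + β * c := by rw [← add_mul, hαβ, one_mul]
    nlinarith [mul_le_mul_of_nonneg_left hx hα, mul_le_mul_of_nonneg_left hy hβ]
  refine convexHull_min ?_ hconv hz
  rintro _ ⟨p, hp, rfl⟩
  have := h p hp
  unfold det at this
  simp only [gridToPlane, Set.mem_ofPred_eq]
  exact_mod_cast this

/-- A point that is lowest in two directions forming a basis of the grid is a vertex. -/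
theorem mem_extremePoints_hull {U : Set (ℤ × ℤ)} {p d e : ℤ × ℤ} (hde : det d e = 1) (hp : p ∈ U)
    (hd : ∀ q ∈ U, det d p ≤ det d q) (he : ∀ q ∈ U, det e p ≤ det e q) :
    gridToPlane p ∈ (hull U).extremePoints ℝ := by
  rw [mem_extremePoints_iff_left]
  refine ⟨gridToPlane_mem_hull hp, fun y hy z hz hyz => ?_⟩
  obtain ⟨α, β, hα, hβ, hαβ, h⟩ := hyz
  have hy1 := le_of_mem_hull hd hy
  have hy2 := le_of_mem_hull he hy
  have hz1 := le_of_mem_hull hd hz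
  have hz2 := le_of_mem_hull he hz
  have h1 : α * y.1 + β * z.1 = p.1 := congrArg Prod.fst h
  have h2 : α * y.2 + β * z.2 = p.2 := congrArg Prod.snd h
  have hdet : (d.1 : ℝ) * e.2 - d.2 * e.1 = 1 := by unfold det at hde; exact_mod_cast hde
  unfold det at hy1 hy2 hz1 hz2
  push_cast at hy1 hy2 hz1 hz2
  have e1 : (d.1 : ℝ) * y.2 - d.2 * y.1 = d.1 * p.2 - d.2 * p.1 := by
    refine le_antisymm ?_ hy1
    have : α * ((d.1 : ℝ) * y.2 - d.2 * y.1) ≤ α * (d.1 * p.2 - d.2 * p.1) := by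
      have h3 := mul_le_mul_of_nonneg_left hz1 hβ.le
      have h4 : α * ((d.1 : ℝ) * y.2 - d.2 * y.1) + β * ((d.1 : ℝ) * z.2 - d.2 * z.1) =
          (α + β) * (d.1 * p.2 - d.2 * p.1) := by
        rw [hαβ, ← h1, ← h2]; ring
      rw [add_mul] at h4
      linarith
    exact le_of_mul_le_mul_left this hα
  have e2 : (e.1 : ℝ) * y.2 - e.2 * y.1 = e.1 * p.2 - e.2 * p.1 := by
    refine le_antisymm ?_ hy2
    have : α * ((e.1 : ℝ) * y.2 - e.2 * y.1) ≤ α * (e.1 * p.2 - e.2 * p.1) := by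
      have h3 := mul_le_mul_of_nonneg_left hz2 hβ.le
      have h4 : α * ((e.1 : ℝ) * y.2 - e.2 * y.1) + β * ((e.1 : ℝ) * z.2 - e.2 * z.1) =
          (α + β) * (e.1 * p.2 - e.2 * p.1) := by
        rw [hαβ, ← h1, ← h2]; ring
      rw [add_mul] at h4
      linarith
    exact le_of_mul_le_mul_left this hα
  ext
  · show y.1 = (p.1 : ℝ)
    linear_combination e.1 * e1 - d.1 * e2 - (y.1 - p.1) * hdet
  · show y.2 = (p.2 : ℝ)
    linear_combination e.2 * e1 - d.2 * e2 - (y.2 - p.2) * hdet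

namespace FareySequence

/-- The grid points on or above the lines of directions `e.dir i` through the points `q i`. -/
def region {t : ℤ} (e : FareySequence t) (q : ℤ → ℤ × ℤ) : Set (ℤ × ℤ) :=
  {p | ∀ i, det (e.dir i) (q i) ≤ det (e.dir i) p}

theorem add_vertical_mem_region {t : ℤ} (e : FareySequence t) {q : ℤ → ℤ × ℤ} {p : ℤ × ℤ}
    (hp : p ∈ e.region q) : p + (0, 1) ∈ e.region q := by
  intro i
  have h := hp i
  have := e.pos i
  rw [det_add_right]
  simp only [det] at *
  linarith

variable {s : ℤ} (e : FareySequence (2 * s + 1)) (Q : ℤ → ℤ × ℤ)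

theorem det_vertex_succ_of_advances {m : ℕ} {i : ℤ} (h : e.Advances Q m i) :
    det (e.dir i) (e.vertex s Q (m + 1) i) = det (e.dir i) (e.vertex s Q m i) + 1 := by
  unfold Advances at h
  rw [vertex_succ, if_pos h, one_smul, det_sub_right, det_add_right, det_smul_right, det_self,
    e.det_succ, mul_zero, sub_zero]

theorem det_vertex_succ_of_not_advances {m : ℕ} {i : ℤ} (h : ¬ e.Advances Q m i) :
    det (e.dir i) (e.vertex s Q (m + 1) i) = det (e.dir i) (e.vertex s Q m i) := by
  unfold Advances at h
  rw [vertex_succ, if_neg h, zero_smul, add_zero, det_sub_right, det_smul_right, det_self,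
    mul_zero, sub_zero]

theorem region_vertex_succ_subset (m : ℕ) :
    e.region (e.vertex s Q (m + 1)) ⊆ e.region (e.vertex s Q m) := by
  intro p hp i
  have h := hp i
  by_cases hA : e.Advances Q m i
  · rw [e.det_vertex_succ_of_advances Q hA] at h; omega
  · rwa [e.det_vertex_succ_of_not_advances Q hA] at h

variable {Q}

/-- If the initial edges are short enough, then all grid points on an edge that advances are
vertices of the hull. -/
theorem peel_region_subset (hs : 0 ≤ s) {w : ℤ → ℤ}
    (hQ : ∀ i, Q (i + 1) = Q i + w (i + 1) • e.dir (i + 1))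
    (hw : ∀ i, w i * (e.dir i).1 ≤ 2 * s + 1) (m : ℕ) :
    peel (e.region (e.vertex s Q m)) ⊆ e.region (e.vertex s Q (m + 1)) := by
  rintro p ⟨hp, hpe⟩ i
  obtain ⟨i, rfl⟩ : ∃ j, i = j + 1 := ⟨i - 1, by ring⟩
  by_cases hA : e.Advances Q m (i + 1)
  swap
  · rw [e.det_vertex_succ_of_not_advances Q hA]; exact hp (i + 1)
  rw [e.det_vertex_succ_of_advances Q hA]
  by_contra hlt
  obtain ⟨a, ha, -, ha1⟩ := e.exists_length Q hs hQ m i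
  obtain ⟨a', ha', -⟩ := e.exists_length Q hs hQ m (i + 1)
  have ha1 := ha1 (hw _) hA
  have hp0 := hp i
  have hp1 := hp (i + 1)
  have hp2 := hp (i + 1 + 1)
  have tight : det (e.dir (i + 1)) (e.vertex s Q m (i + 1)) =
      det (e.dir (i + 1)) (e.vertex s Q m i) := by
    rw [ha, det_add_right, det_smul_right, det_self, mul_zero, add_zero]
  have tight' : det (e.dir (i + 1 + 1)) (e.vertex s Q m (i + 1 + 1)) =
      det (e.dir (i + 1 + 1)) (e.vertex s Q m (i + 1)) := by
    rw [ha', det_add_right, det_smul_right, det_self, mul_zero, add_zero]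
  -- A surviving p on the old line has the form `vertex i + j • dir` with 0 ≤ j ≤ a ≤ 1. It is
  -- therefore an end of the edge, lowest in two unimodular directions, and should have been
  -- removed.
  have hv := eq_smul_sub_smul (e.det_succ i) (p - e.vertex s Q m i)
  have hz : det (e.dir (i + 1)) (p - e.vertex s Q m i) = 0 := by rw [det_sub_right]; omega
  rw [hz, zero_smul, sub_zero] at hv
  set j := det (e.dir i) (p - e.vertex s Q m i) with hj
  have hj0 : 0 ≤ j := by rw [hj, det_sub_right]; omega
  have hv' : p - e.vertex s Q m (i + 1) = (j - a) • e.dir (i + 1) := by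
    rw [ha, ← sub_sub, hv, sub_smul]
  have hja : j ≤ a := by
    have h1 : 0 ≤ det (e.dir (i + 1 + 1)) (p - e.vertex s Q m (i + 1)) := by
      rw [det_sub_right]; omega
    rw [hv', det_smul_right, det_swap, e.det_succ] at h1
    linarith
  rcases (show j = 0 ∨ j = 1 by omega) with h | h
  · rw [h, zero_smul, sub_eq_zero] at hv
    rw [hv] at hp hpe
    exact hpe (mem_extremePoints_hull (e.det_succ i) hp (fun q hq => hq i)
      (fun q hq => tight ▸ hq (i + 1)))
  · rw [show j - a = 0 by omega, zero_smul, sub_eq_zero] at hv'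
    rw [hv'] at hp hpe
    exact hpe (mem_extremePoints_hull (e.det_succ (i + 1)) hp (fun q hq => hq (i + 1))
      (fun q hq => tight' ▸ hq (i + 1 + 1)))

theorem peel_iterate_region_subset (hs : 0 ≤ s) {w : ℤ → ℤ}
    (hQ : ∀ i, Q (i + 1) = Q i + w (i + 1) • e.dir (i + 1))
    (hw : ∀ i, w i * (e.dir i).1 ≤ 2 * s + 1) (m : ℕ) :
    peel^[m] (e.region Q) ⊆ e.region (e.vertex s Q m) := by
  induction m with
  | zero => exact subset_rfl
  | succ m ih =>
    rw [Function.iterate_succ_apply']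
    exact (peel_mono ih).trans (e.peel_region_subset hs hQ hw m)

/-- The vertices of a convex chain satisfy all constraints. -/
theorem mem_region_of_chain {t : ℤ} (e : FareySequence t) {q : ℤ → ℤ × ℤ}
    (hq : ∀ i, ∃ a : ℤ, 0 ≤ a ∧ q (i + 1) = q i + a • e.dir (i + 1)) (j : ℤ) :
    q j ∈ e.region q := by
  intro i
  rcases le_total i j with h | h
  · induction j, h using Int.leInduction with
    | base => exact le_rfl
    | succ j hij ih =>
      obtain ⟨a, ha, h⟩ := hq j
      rw [h, det_add_right, det_smul_right]
      have := mul_nonneg ha (e.det_nonneg (show i ≤ j + 1 by omega))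
      linarith
  · induction j, h using Int.leInductionDown with
    | base => exact le_rfl
    | pred j hij ih =>
      obtain ⟨a, ha, h⟩ := hq (j - 1)
      rw [sub_add_cancel] at h
      rw [h, det_add_right, det_smul_right, det_swap (e.dir j)] at ih
      have := mul_nonneg ha (e.det_nonneg (show j ≤ i by omega))
      linarith

end FareySequence
-- Chains with long edges
/-- A grid point strictly between two points of the hull is not a vertex. -/
theorem mem_peel_of_openSegment {U : Set (ℤ × ℤ)} {p : ℤ × ℤ} (hp : p ∈ U) {y z : ℝ × ℝ}
    (hy : y ∈ hull U) (hz : z ∈ hull U) (hyz : gridToPlane p ∈ openSegment ℝ y z)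
    (hne : y ≠ gridToPlane p) : p ∈ peel U :=
  ⟨hp, fun h => hne ((mem_extremePoints_iff_left.1 h).2 y hy z hz hyz)⟩

/-- A grid point that lies over an edge and is not one of its endpoints is not a vertex, provided
that the grid point above it is present. -/
theorem mem_peel_of_above_edge {U : Set (ℤ × ℤ)} {p q d : ℤ × ℤ} {a : ℤ}
    (hp : p ∈ U) (hp' : p + (0, 1) ∈ U) (hq : q ∈ U) (hqa : q + a • d ∈ U) (hd : 0 < d.1)
    (h1 : q.1 ≤ p.1) (h2 : p.1 < q.1 + a * d.1) (hne : p ≠ q) (h3 : det d q ≤ det d p) :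
    p ∈ peel U := by
  have hqh := gridToPlane_mem_hull hq
  have hqah := gridToPlane_mem_hull hqa
  have had : (0 : ℝ) < a * d.1 := by
    have : 0 < a * d.1 := by omega
    exact_mod_cast this
  have hdR : (0 : ℝ) < d.1 := by exact_mod_cast hd
  have h1R : (q.1 : ℝ) ≤ p.1 := by exact_mod_cast h1
  have h2R : (p.1 : ℝ) < q.1 + a * d.1 := by exact_mod_cast h2
  set θ : ℝ := (p.1 - q.1) / (a * d.1) with hθ
  have hθ0 : 0 ≤ θ := div_nonneg (by linarith) had.le
  have hθ1 : θ < 1 := by rw [hθ, div_lt_one had]; linarith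
  have hθa : θ * (a * d.1) = p.1 - q.1 := div_mul_cancel₀ _ had.ne'
  rcases h3.eq_or_lt with h | h
  · have hθpos : 0 < θ := by
      rcases hθ0.eq_or_lt with h0 | h0
      · exfalso
        rw [← h0, zero_mul] at hθa
        have e1 : p.1 = q.1 := by
          have : (p.1 : ℝ) = q.1 := by linarith
          exact_mod_cast this
        unfold det at h
        rw [e1] at h
        have e2 : p.2 = q.2 := by
          have : d.1 * q.2 = d.1 * p.2 := by linarith
          exact (mul_left_cancel₀ hd.ne' this).symm
        exact hne (Prod.ext e1 e2)
      · exact h0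
    refine mem_peel_of_openSegment hp hqh hqah ⟨1 - θ, θ, by linarith, hθpos, by ring, ?_⟩ ?_
    · have hR : (d.1 : ℝ) * q.2 - d.2 * q.1 = d.1 * p.2 - d.2 * p.1 := by
        unfold det at h; exact_mod_cast h
      have hmul : (d.1 : ℝ) * (θ * (a * d.2)) = d.1 * (p.2 - q.2) := by
        linear_combination (d.2 : ℝ) * hθa + hR
      have hc := mul_left_cancel₀ hdR.ne' hmul
      ext
      · simp only [gridToPlane, Prod.fst_add, Prod.smul_fst, smul_eq_mul]
        push_cast
        linear_combination hθa
      · simp only [gridToPlane, Prod.snd_add, Prod.smul_snd, smul_eq_mul]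
        push_cast
        linear_combination hc
    · intro heq
      have e1 := congrArg Prod.fst heq
      simp only [gridToPlane] at e1
      have : 0 < θ * (a * d.1) := mul_pos hθpos had
      linarith
  -- Strictly above the edge, p lies inside the vertical segment from the edge to the grid point p +
  -- (0, 1).
  · have hs : (1 - θ) • gridToPlane q + θ • gridToPlane (q + a • d) ∈ hull U :=
      (convex_convexHull ℝ _) hqh hqah (by linarith) hθ0 (by ring)
    set z := (1 - θ) • gridToPlane q + θ • gridToPlane (q + a • d) with hz
    have hz1 : z.1 = p.1 := by
      simp only [hz, gridToPlane, Prod.fst_add, Prod.smul_fst, smul_eq_mul]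
      push_cast
      linear_combination hθa
    have hz2 : z.2 = q.2 + θ * (a * d.2) := by
      simp only [hz, gridToPlane, Prod.snd_add, Prod.smul_snd, smul_eq_mul]
      push_cast
      ring
    have hz3 : z.2 < p.2 := by
      have hR : (d.1 : ℝ) * q.2 - d.2 * q.1 < d.1 * p.2 - d.2 * p.1 := by
        unfold det at h; exact_mod_cast h
      have : (d.1 : ℝ) * z.2 < d.1 * p.2 := by
        rw [hz2]
        linear_combination hR + (d.2 : ℝ) * hθa
      exact lt_of_mul_lt_mul_left this hdR.le
    have hpos : (0 : ℝ) < p.2 + 1 - z.2 := by linarith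
    refine mem_peel_of_openSegment hp hs (gridToPlane_mem_hull hp')
      ⟨1 / (p.2 + 1 - z.2), (p.2 - z.2) / (p.2 + 1 - z.2), by positivity,
        div_pos (by linarith) hpos, ?_, ?_⟩ ?_
    · field_simp; ring
    · ext
      · simp only [gridToPlane, Prod.fst_add, Prod.smul_fst, smul_eq_mul, hz1]
        push_cast
        field_simp; ring
      · simp only [gridToPlane, Prod.snd_add, Prod.smul_snd, smul_eq_mul]
        push_cast
        field_simp; ring
    · intro heq
      rw [heq] at hz3
      simp only [gridToPlane, lt_self_iff_false] at hz3

namespace FareySequence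

variable {s : ℤ} (e : FareySequence (2 * s + 1)) {Q : ℤ → ℤ × ℤ}

/-- If the initial edges are long enough, then each vertex lies on an edge that advances. -/
theorem region_succ_subset_peel (hs : 0 ≤ s) {w : ℤ → ℤ}
    (hQ : ∀ i, Q (i + 1) = Q i + w (i + 1) • e.dir (i + 1))
    (hw : ∀ i, 2 * s < (w i + 1) * (e.dir i).1)
    (htop : ∀ u : ℤ, ∃ i, u < (Q i).1) (hbot : ∀ u : ℤ, ∃ i, (Q i).1 < u) (m : ℕ) :
    e.region (e.vertex s Q (m + 1)) ⊆ peel (e.region (e.vertex s Q m)) := by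
  intro p hp
  have hchain : ∀ i, ∃ a : ℤ, 0 ≤ a ∧
      e.vertex s Q m (i + 1) = e.vertex s Q m i + a • e.dir (i + 1) := fun i => by
    obtain ⟨a, ha, h0, -⟩ := e.exists_length Q hs hQ m i
    exact ⟨a, h0 (hw _), ha⟩
  have hmem := e.mem_region_of_chain hchain
  have hmono : Monotone fun i => (e.vertex s Q m i).1 := by
    refine monotone_int_of_le_succ fun i => ?_
    obtain ⟨a, ha, h⟩ := hchain i
    show _ ≤ (e.vertex s Q m (i + 1)).1
    rw [h]
    have := mul_nonneg ha (e.pos (i + 1)).le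
    simp only [Prod.fst_add, Prod.smul_fst, smul_eq_mul]
    linarith
  obtain ⟨i, hi, hmax⟩ : ∃ i, (e.vertex s Q m i).1 ≤ p.1 ∧
      ∀ j, (e.vertex s Q m j).1 ≤ p.1 → j ≤ i := by
    refine Int.exists_greatest_of_bdd ?_ ?_
    · obtain ⟨b, hb⟩ := htop (p.1 + s)
      refine ⟨b, fun z hz => ?_⟩
      by_contra hlt
      have h1 : (e.vertex s Q m b).1 ≤ (e.vertex s Q m z).1 := hmono (by omega)
      have h2 := (e.vertex_sub_mem Q hs m b).1
      omega
    · obtain ⟨b, hb⟩ := hbot (p.1 - s)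
      have h2 := (e.vertex_sub_mem Q hs m b).2
      exact ⟨b, by omega⟩
  obtain ⟨a, ha, h⟩ := hchain i
  have hlt : p.1 < (e.vertex s Q m (i + 1)).1 := by
    by_contra hle
    have := hmax (i + 1) (by omega)
    omega
  have hpm := e.region_vertex_succ_subset Q m hp
  have tight : det (e.dir (i + 1)) (e.vertex s Q m (i + 1)) =
      det (e.dir (i + 1)) (e.vertex s Q m i) := by
    rw [h, det_add_right, det_smul_right, det_self, mul_zero, add_zero]
  refine mem_peel_of_above_edge (q := e.vertex s Q m i) (d := e.dir (i + 1)) (a := a) hpm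
    (e.add_vertical_mem_region hpm) (hmem i) (h ▸ hmem (i + 1)) (e.pos _) hi ?_ ?_ ?_
  · rw [h] at hlt
    simpa using hlt
  · rintro rfl
    -- If p were the vertex itself, one of its two edges would advance and leave it below the new
    -- line.
    rcases e.advances_or Q m i with hA | hA
    · have := hp i
      rw [e.det_vertex_succ_of_advances Q hA] at this
      omega
    · have := hp (i + 1)
      rw [e.det_vertex_succ_of_advances Q ((e.advances_iff Q hs hQ m i).2 hA), tight] at this
      omega
  · rw [← tight]; exact hpm (i + 1)

theorem region_subset_peel_iterate (hs : 0 ≤ s) {w : ℤ → ℤ}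
    (hQ : ∀ i, Q (i + 1) = Q i + w (i + 1) • e.dir (i + 1))
    (hw : ∀ i, 2 * s < (w i + 1) * (e.dir i).1)
    (htop : ∀ u : ℤ, ∃ i, u < (Q i).1) (hbot : ∀ u : ℤ, ∃ i, (Q i).1 < u) (m : ℕ) :
    e.region (e.vertex s Q m) ⊆ peel^[m] (e.region Q) := by
  induction m with
  | zero => exact subset_rfl
  | succ m ih =>
    rw [Function.iterate_succ_apply']
    exact (e.region_succ_subset_peel hs hQ hw htop hbot m).trans (peel_mono ih)

end FareySequence
-- Construction of Farey sequences and periodic chains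
-- The solutions of det = 1 differ by multiples of (x, y); the one of largest extent not exceeding t
-- is taken, which forces its extent above t - x.
theorem exists_next {t x y : ℤ} (hx : 0 < x) (hxt : x ≤ t) (hc : IsCoprime x y) :
    ∃ d : ℤ × ℤ, det (x, y) d = 1 ∧ 0 < d.1 ∧ d.1 ≤ t ∧ t < x + d.1 := by
  obtain ⟨r, u, h⟩ := hc
  have h1 := Int.emod_nonneg (t + u) hx.ne'
  have h2 := Int.emod_lt_of_pos (t + u) hx
  have h3 := Int.emod_add_ediv_mul (t + u) x
  refine ⟨(-u + (t + u) / x * x, r + (t + u) / x * y), ?_, ?_, ?_, ?_⟩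
  · simp only [det]; linear_combination h
  all_goals simp only; omega

theorem isCoprime_of_det_eq_one {d e : ℤ × ℤ} (h : det d e = 1) : IsCoprime e.1 e.2 := by
  unfold det at h
  exact ⟨-d.2, d.1, by linarith⟩

/-- The successors of `(1, 0)` among the directions of extent at most `t`. -/
theorem exists_base {t : ℤ} (ht : 1 ≤ t) : ∃ b : ℕ → ℤ × ℤ, b 0 = (1, 0) ∧
    ∀ n, det (b n) (b (n + 1)) = 1 ∧ 0 < (b n).1 ∧ (b n).1 ≤ t ∧ t < (b n).1 + (b (n + 1)).1 := by
  have step : ∀ d : {d : ℤ × ℤ // 0 < d.1 ∧ d.1 ≤ t ∧ IsCoprime d.1 d.2},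
      ∃ d' : {d : ℤ × ℤ // 0 < d.1 ∧ d.1 ≤ t ∧ IsCoprime d.1 d.2},
        det d.1 d'.1 = 1 ∧ t < d.1.1 + d'.1.1 := by
    rintro ⟨⟨x, y⟩, h1, h2, h3⟩
    obtain ⟨d, h4, h5, h6, h7⟩ := exists_next h1 h2 h3
    exact ⟨⟨d, h5, h6, isCoprime_of_det_eq_one h4⟩, h4, h7⟩
  choose next hnext using step
  refine ⟨fun n => (next^[n] ⟨(1, 0), one_pos, ht, isCoprime_one_left⟩).1, rfl, fun n => ?_⟩
  set d := next^[n] ⟨(1, 0), one_pos, ht, isCoprime_one_left⟩ with hd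
  have hd' : next^[n + 1] ⟨(1, 0), one_pos, ht, isCoprime_one_left⟩ = next d := by
    rw [Function.iterate_succ_apply']
  simp only [hd']
  exact ⟨(hnext d).1, d.2.1, d.2.2.1, (hnext d).2⟩

theorem div_lt_div_of_det_pos {d e : ℤ × ℤ} (hd : 0 < d.1) (he : 0 < e.1) (h : 0 < det d e) :
    (d.2 : ℚ) / d.1 < e.2 / e.1 := by
  have h1 : (0 : ℚ) < d.1 := by exact_mod_cast hd
  have h2 : (0 : ℚ) < e.1 := by exact_mod_cast he
  rw [div_lt_div_iff₀ h1 h2]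
  unfold det at h
  have : d.2 * e.1 < e.2 * d.1 := by linarith
  exact_mod_cast this

/-- The slopes in `(0, 1]` with denominator at most `t` in increasing order. -/
theorem exists_base_period {t : ℕ} (ht : 1 ≤ t) : ∃ (b : ℕ → ℤ × ℤ) (N : ℕ), b 0 = (1, 0) ∧
    (∀ n, det (b n) (b (n + 1)) = 1 ∧ 0 < (b n).1 ∧ (b n).1 ≤ t ∧
      (t : ℤ) < (b n).1 + (b (n + 1)).1) ∧ 0 < N ∧ b N = (1, 1) ∧
    ∀ g : ℤ → ℤ, ∑ i ∈ Finset.range N, g (b (i + 1)).1 =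
      ∑ p ∈ primitiveVectors t, g (p.1 : ℤ) := by
  obtain ⟨b, hb0, hb⟩ := exists_base (t := t) (by exact_mod_cast ht)
  have hmono : StrictMono fun n => ((b n).2 : ℚ) / (b n).1 := by
    refine strictMono_nat_of_lt_succ fun n => ?_
    exact div_lt_div_of_det_pos (hb n).2.1 (hb (n + 1)).2.1 (by rw [(hb n).1]; exact one_pos)
  have hinj : Function.Injective b := fun m n h => hmono.injective (by simp only [h])
  have hnonneg : ∀ n, 0 ≤ (b n).2 := by
    intro n
    induction n with
    | zero => rw [hb0]
    | succ n ih =>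
      have h1 := (hb n).1
      have h2 := (hb n).2.1
      have h3 := (hb (n + 1)).2.1
      unfold det at h1
      have h4 : 0 < (b n).1 * (b (n + 1)).2 := by nlinarith
      exact ((mul_pos_iff_of_pos_left h2).1 h4).le
  have hpos : ∀ n, 0 < (b (n + 1)).2 := by
    intro n
    have h1 := (hb n).1
    have h2 := (hb n).2.1
    have h3 := (hb (n + 1)).2.1
    unfold det at h1
    have h4 : 0 < (b n).1 * (b (n + 1)).2 := by nlinarith [mul_nonneg (hnonneg n) h3.le]
    exact (mul_pos_iff_of_pos_left h2).1 h4
  -- The slopes increase strictly, and only finitely many admissible vectors have slope below 1.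
  have hex : ∃ n, (b n).1 ≤ (b n).2 := by
    by_contra hno
    push Not at hno
    have hfin : (Set.range b).Finite := by
      refine Set.Finite.subset (Finset.finite_toSet
        (Finset.Icc (1 : ℤ) t ×ˢ Finset.Icc (0 : ℤ) t)) ?_
      rintro _ ⟨n, rfl⟩
      have h1 := hno n
      have h2 := hb n
      have h3 := hnonneg n
      simp only [Finset.coe_product, Finset.coe_Icc, Set.mem_prod, Set.mem_Icc]
      omega
    exact Set.infinite_range_of_injective hinj hfin
  classical
  obtain ⟨N, hN, hmin⟩ : ∃ N, (b N).1 ≤ (b N).2 ∧ ∀ n < N, (b n).2 < (b n).1 :=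
    ⟨Nat.find hex, Nat.find_spec hex, fun n hn => not_le.1 (Nat.find_min hex hn)⟩
  obtain ⟨M, rfl⟩ : ∃ M, N = M + 1 := by
    refine Nat.exists_eq_succ_of_ne_zero ?_
    rintro rfl
    rw [hb0] at hN
    norm_num at hN
  have hbN : b (M + 1) = (1, 1) := by
    have h1 := (hb M).1
    have h2 := (hb M).2
    have h3 := (hb (M + 1)).2.1
    have h4 := hmin M (by omega)
    unfold det at h1
    have h5 : (b (M + 1)).2 = (b (M + 1)).1 := by
      by_contra hne
      have h6 : (b (M + 1)).1 + 1 ≤ (b (M + 1)).2 := by omega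
      have h7 := mul_le_mul_of_nonneg_left h6 h2.1.le
      have h8 : (b M).2 * (b (M + 1)).1 ≤ ((b M).1 - 1) * (b (M + 1)).1 :=
        mul_le_mul_of_nonneg_right (by omega) h3.le
      have h9 : (1 : ℤ) ≤ t := by exact_mod_cast ht
      nlinarith
    rw [h5] at h1
    have h6 : ((b M).1 - (b M).2) * (b (M + 1)).1 = 1 := by linarith
    have h7 : (b (M + 1)).1 = 1 := by
      rcases Int.eq_one_or_neg_one_of_mul_eq_one (u := (b (M + 1)).1)
        (v := (b M).1 - (b M).2) (by linarith) with h | h <;> omega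
    exact Prod.ext h7 (h5.trans h7)
  refine ⟨b, M + 1, hb0, hb, by omega, hbN, fun g => ?_⟩
  refine Finset.sum_bij (fun i _ => ((b (i + 1)).1.toNat, (b (i + 1)).2.toNat)) ?_ ?_ ?_ ?_
  · intro i hi
    have h1 := (hb (i + 1)).2
    have h2 := hpos i
    have h3 : (b (i + 1)).2 ≤ (b (i + 1)).1 := by
      rcases Nat.lt_or_ge (i + 1) (M + 1) with h | h
      · exact (hmin _ h).le
      · have : i = M := by have := Finset.mem_range.1 hi; omega
        rw [this, hbN]
    have h4 := isCoprime_of_det_eq_one (hb i).1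
    simp only [primitiveVectors, Finset.mem_filter, Finset.mem_product, Finset.mem_Icc]
    refine ⟨by omega, by omega, ?_⟩
    rw [← Nat.isCoprime_iff_coprime, Int.toNat_of_nonneg h1.1.le, Int.toNat_of_nonneg h2.le]
    exact h4
  · intro i _ j _ h
    have h1 := (hb (i + 1)).2.1
    have h2 := (hb (j + 1)).2.1
    have h3 := hpos i
    have h4 := hpos j
    simp only [Prod.mk.injEq] at h
    have := hinj (Prod.ext (by omega) (by omega) : b (i + 1) = b (j + 1))
    omega
  · rintro ⟨x, y⟩ hxy
    simp only [primitiveVectors, Finset.mem_filter, Finset.mem_product, Finset.mem_Icc] at hxy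
    obtain ⟨⟨⟨hx, hxt⟩, hy, -⟩, hyx, hc⟩ := hxy
    set p : ℤ × ℤ := (x, y) with hp
    have hlast : det (b (M + 1)) p ≤ 0 := by
      rw [hbN, hp]; simp only [det]; omega
    obtain ⟨n, hn, hnmin⟩ : ∃ n, det (b n) p ≤ 0 ∧ ∀ k < n, 0 < det (b k) p :=
      have hex' : ∃ n, det (b n) p ≤ 0 := ⟨_, hlast⟩
      ⟨Nat.find hex', Nat.find_spec hex', fun k hk => not_le.1 (Nat.find_min hex' hk)⟩
    have hnM : n ≤ M + 1 := by
      by_contra hlt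
      exact absurd (hnmin (M + 1) (by omega)) (not_lt.2 hlast)
    obtain ⟨i, rfl⟩ : ∃ i, n = i + 1 := by
      refine Nat.exists_eq_succ_of_ne_zero ?_
      rintro rfl
      rw [hb0, hp] at hn
      simp only [det] at hn
      omega
    refine ⟨i, Finset.mem_range.2 (by omega), ?_⟩
    have h1 := hnmin i (by omega)
    have h2 := eq_smul_sub_smul (hb i).1 p
    have h3 := (hb i).2.1
    have h4 := (hb (i + 1)).2.1
    have h5 := (hb i).2.2.2
    -- A vector strictly between consecutive directions is a positive integer combination of both,
    -- so its extent would exceed t. Hence no slope is skipped.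
    have h6 : det (b (i + 1)) p = 0 := by
      by_contra hne
      have h7 : 1 ≤ - det (b (i + 1)) p := by omega
      have h8 := congrArg Prod.fst h2
      simp only [Prod.fst_sub, Prod.smul_fst, smul_eq_mul, hp] at h8 h7 h1
      have h9 : (x : ℤ) ≤ t := by exact_mod_cast hxt
      nlinarith
    rw [h6, zero_smul, sub_zero] at h2
    have hunit : IsUnit (det (b i) p) := by
      have hc' : IsCoprime (x : ℤ) (y : ℤ) := Nat.isCoprime_iff_coprime.2 hc
      refine hc'.isUnit_of_dvd' ⟨(b (i + 1)).1, ?_⟩ ⟨(b (i + 1)).2, ?_⟩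
      · simpa [hp] using congrArg Prod.fst h2
      · simpa [hp] using congrArg Prod.snd h2
    have hone : det (b i) p = 1 := by
      rcases Int.isUnit_iff.1 hunit with h | h <;> omega
    rw [hone, one_smul] at h2
    rw [← h2, hp]
    simp
  · intro i _
    rw [Int.toNat_of_nonneg (hb (i + 1)).2.1.le]

/-- The sequence of all reduced slopes with denominator at most `t`, which is invariant under
the shear that adds one to all slopes. -/
theorem exists_fareySequence {t : ℕ} (ht : 1 ≤ t) : ∃ (e : FareySequence t) (N : ℕ), 0 < N ∧
    e.dir 0 = (1, 0) ∧
    (∀ i k : ℤ, e.dir (i + N * k) = ((e.dir i).1, (e.dir i).2 + k * (e.dir i).1)) ∧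
    ∀ g : ℤ → ℤ, ∑ i ∈ Finset.range N, g (e.dir (i + 1)).1 =
      ∑ p ∈ primitiveVectors t, g (p.1 : ℤ) := by
  obtain ⟨b, N, hb0, hb, hN, hbN, hsum⟩ := exists_base_period ht
  have hNZ : (0 : ℤ) < N := by exact_mod_cast hN
  set f : ℤ → ℤ × ℤ := fun i => ((b (i % N).toNat).1,
    (b (i % N).toNat).2 + i / N * (b (i % N).toNat).1) with hf
  have hf_lt : ∀ (k : ℤ) (n : ℕ), n < N → f (n + N * k) = ((b n).1, (b n).2 + k * (b n).1) := by
    intro k n hn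
    have h1 : ((n : ℤ) + N * k) % N = n := by
      rw [Int.add_mul_emod_self_left, Int.emod_eq_of_lt (by omega) (by omega)]
    have h2 : ((n : ℤ) + N * k) / N = k := by
      rw [Int.add_mul_ediv_left _ _ hNZ.ne', Int.ediv_eq_zero_of_lt (by omega) (by omega), zero_add]
    simp only [hf, h1, h2, Int.toNat_natCast]
  have hf_le : ∀ (k : ℤ) (n : ℕ), n ≤ N → f (n + N * k) = ((b n).1, (b n).2 + k * (b n).1) := by
    intro k n hn
    rcases hn.lt_or_eq with h | rfl
    · exact hf_lt k n h
    · have := hf_lt (k + 1) 0 hN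
      rw [hbN]
      rw [hb0] at this
      rw [show (n : ℤ) + n * k = ((0 : ℕ) : ℤ) + n * (k + 1) by push_cast; ring, this]
      simp [add_comm]
  have hrep : ∀ i : ℤ, ∃ (k : ℤ) (n : ℕ), n < N ∧ i = n + N * k := by
    intro i
    refine ⟨i / N, (i % N).toNat, ?_, ?_⟩
    · have := Int.emod_lt_of_pos i hNZ
      omega
    · rw [Int.toNat_of_nonneg (Int.emod_nonneg i hNZ.ne'), Int.emod_add_mul_ediv]
  have hsucc : ∀ (k : ℤ) (n : ℕ), n < N → f (n + N * k + 1) =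
      ((b (n + 1)).1, (b (n + 1)).2 + k * (b (n + 1)).1) := by
    intro k n hn
    rw [← hf_le k (n + 1) hn]
    congr 1
    push_cast
    ring
  have hdet : ∀ i, det (f i) (f (i + 1)) = 1 := by
    intro i
    obtain ⟨k, n, hn, rfl⟩ := hrep i
    rw [hsucc k n hn, hf_lt k n hn, ← (hb n).1]
    simp only [det]
    ring
  refine ⟨⟨f, hdet, fun i => ?_, fun i => ?_, fun i => ?_⟩, N, hN, ?_, fun i k => ?_, fun g => ?_⟩
  · exact (hb _).2.1
  · exact (hb _).2.2.1
  · obtain ⟨k, n, hn, rfl⟩ := hrep i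
    rw [hsucc k n hn, hf_lt k n hn]
    exact (hb n).2.2.2
  · have := hf_lt 0 0 hN
    simpa [hb0] using this
  · obtain ⟨k', n, hn, rfl⟩ := hrep i
    show f _ = ((f _).1, (f _).2 + k * (f _).1)
    rw [show (n : ℤ) + N * k' + N * k = n + N * (k' + k) by ring, hf_lt _ n hn, hf_lt _ n hn]
    simp only [Prod.mk.injEq, true_and]
    ring
  · rw [← hsum g]
    refine Finset.sum_congr rfl fun i hi => ?_
    have := hsucc 0 i (Finset.mem_range.1 hi)
    simp only [mul_zero, add_zero] at this
    show g (f (i + 1)).1 = _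
    rw [this]

theorem exists_int_primitive {G : Type*} [AddCommGroup G] (f : ℤ → G) :
    ∃ S : ℤ → G, S 0 = 0 ∧ ∀ i, S (i + 1) = S i + f i := by
  refine ⟨fun i => match i with
    | Int.ofNat n => ∑ k ∈ Finset.range n, f k
    | Int.negSucc n => -∑ k ∈ Finset.range (n + 1), f (-k - 1), rfl, fun i => ?_⟩
  rcases i with n | n
  · exact Finset.sum_range_succ _ _
  · cases n with
    | zero => simp [Int.negSucc_eq]
    | succ n =>
      have : Int.negSucc (n + 1) + 1 = Int.negSucc n := by simp only [Int.negSucc_eq]; push_cast; ring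
      rw [this]
      show -∑ k ∈ Finset.range (n + 1), f (-k - 1) =
        -∑ k ∈ Finset.range (n + 1 + 1), f (-k - 1) + f (Int.negSucc (n + 1))
      rw [Finset.sum_range_succ _ (n + 1), Int.negSucc_eq]
      have : -((n + 1 : ℕ) : ℤ) - 1 = -(((n + 1 : ℕ) : ℤ) + 1) := by ring
      rw [this]
      abel

/-- A Farey sequence of order `2 * s + 1` together with the chains whose edge in the direction
`(x, y)` has length `W x`. One period of such a chain has horizontal extent
`∑ W x * x` and vertical extent `V` up to a shear. -/
theorem exists_chain (s : ℕ) (W : ℤ → ℤ) {H : ℤ}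
    (hH : H = ∑ p ∈ primitiveVectors (2 * s + 1), W p.1 * p.1) :
    ∃ (e : FareySequence (2 * (s : ℤ) + 1)) (N : ℕ) (V : ℤ), 0 < N ∧
      (∀ k : ℤ, e.dir (N * k) = (1, k)) ∧
      ∀ n j l : ℤ, ∃ Q : ℤ → ℤ × ℤ,
        (∀ i, Q (i + 1) = Q i + W (e.dir (i + 1)).1 • e.dir (i + 1)) ∧
        ∀ k : ℤ, (Q (N * (n + k))).1 = j + k * H ∧
          2 * (Q (N * (n + k))).2 = 2 * l + 2 * k * V + 2 * n * k * H + H * (k * (k - 1)) := by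
  have hF := exists_fareySequence (t := 2 * s + 1) (by omega)
  have hcast : ((2 * s + 1 : ℕ) : ℤ) = 2 * (s : ℤ) + 1 := by push_cast; ring
  rw [hcast] at hF
  obtain ⟨e, N, hN, he0, heN, hsum⟩ := hF
  have hdirN : ∀ k : ℤ, e.dir (N * k) = (1, k) := by
    intro k
    have := heN 0 k
    rw [he0] at this
    simpa using this
  refine ⟨e, N, ∑ r ∈ Finset.range N, W (e.dir (r + 1)).1 * (e.dir (r + 1)).2, hN, hdirN, ?_⟩
  set V := ∑ r ∈ Finset.range N, W (e.dir (r + 1)).1 * (e.dir (r + 1)).2 with hV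
  intro n j l
  obtain ⟨S, -, hS⟩ := exists_int_primitive
    fun i => W (e.dir (i + 1)).1 • e.dir (i + 1)
  have hblock : ∀ (i : ℤ) (M : ℕ), S (i + M) = S i +
      ∑ r ∈ Finset.range M, W (e.dir (i + r + 1)).1 • e.dir (i + r + 1) := by
    intro i M
    induction M with
    | zero => simp
    | succ M ih =>
      rw [Finset.sum_range_succ, ← add_assoc, ← ih, ← hS]
      congr 1
      push_cast
      ring
  -- In block m all slopes are raised by m, which adds m H to the vertical extent V. The sums
  -- produce triangular numbers, hence the doubled ordinate in the statement.
  have hstep : ∀ m : ℤ, S (N * (m + 1)) = S (N * m) + (H, V + m * H) := by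
    intro m
    rw [mul_add, mul_one, hblock]
    congr 1
    have h1 : ∀ r : ℕ, e.dir (N * m + r + 1) =
        ((e.dir (r + 1)).1, (e.dir (r + 1)).2 + m * (e.dir (r + 1)).1) := by
      intro r
      rw [← heN]
      congr 1
      ring
    have h2 : H = ∑ r ∈ Finset.range N, W (e.dir (r + 1)).1 * (e.dir (r + 1)).1 := by
      rw [hH]
      exact (hsum fun x => W x * x).symm
    ext
    · rw [Prod.fst_sum, h2]
      refine Finset.sum_congr rfl fun r _ => ?_
      rw [h1]
      rfl
    · rw [Prod.snd_sum, h2, hV, Finset.mul_sum, ← Finset.sum_add_distrib]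
      refine Finset.sum_congr rfl fun r _ => ?_
      rw [h1]
      simp only [Prod.smul_snd, smul_eq_mul]
      ring
  refine ⟨fun i => S i + ((j, l) - S (N * n)), fun i => ?_, fun k => ?_⟩
  · simp only [hS]
    abel
  · beta_reduce
    induction k using Int.induction_on with
    | zero => simp
    | succ k ih =>
      rw [← add_assoc, hstep]
      simp only [Prod.fst_add, Prod.snd_add] at ih ⊢
      constructor
      · linarith [ih.1]
      · linarith [ih.2]
    | pred k ih =>
      have h := hstep (n + (-k - 1))
      rw [show n + (-(k : ℤ) - 1) + 1 = n + -k by ring] at h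
      rw [h] at ih
      simp only [Prod.fst_add, Prod.snd_add] at ih ⊢
      constructor
      · linarith [ih.1]
      · linarith [ih.2]

/-! ### Comparison of parabolas with chains -/

theorem neg_sq_div_le {p q : ℝ} (hp : 0 < p) (t : ℝ) : -(q ^ 2 / (2 * p)) ≤ p / 2 * t ^ 2 + q * t := by
  have h : p / 2 * t ^ 2 + q * t + q ^ 2 / (2 * p) = p / 2 * (t + q / p) ^ 2 := by
    field_simp; ring
  have : 0 ≤ p / 2 * (t + q / p) ^ 2 := by positivity
  linarith

theorem neg_sq_div_le_of_abs_le {p q M : ℝ} (hp : 0 < p) (hq : |q| ≤ M) (t : ℝ) :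
    -(M ^ 2 / (2 * p)) ≤ p / 2 * t ^ 2 + q * t := by
  refine le_trans ?_ (neg_sq_div_le hp t)
  have : q ^ 2 ≤ M ^ 2 := sq_le_sq' (abs_le.1 hq).1 (abs_le.1 hq).2
  have := div_le_div_of_nonneg_right this (by positivity : 0 ≤ 2 * p)
  linarith

/-- A positive definite quadratic polynomial with bounded linear terms is bounded below. -/
theorem exists_forall_neg_le_quadratic {a H A B : ℝ} (ha : 0 < a) (h : 1 < a * H) :
    ∃ K, ∀ z k α β : ℝ, |α| ≤ A → |β| ≤ B →
      -K ≤ a * z ^ 2 / 2 - k * z + H * k ^ 2 / 2 + α * z + β * k := by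
  -- Completing the square in z leaves H - 1/a as the coefficient of k²/2.
  have hp : 0 < H - 1 / a := by
    rw [sub_pos, div_lt_iff₀ ha]; linarith
  refine ⟨A ^ 2 / (2 * a) + (B + A / a) ^ 2 / (2 * (H - 1 / a)), fun z k α β hα hβ => ?_⟩
  have h1 := neg_sq_div_le_of_abs_le ha hα (z - k / a)
  have h2 : |β + α / a| ≤ B + A / a := by
    refine (abs_add_le _ _).trans (add_le_add hβ ?_)
    rw [abs_div, abs_of_pos ha]
    exact div_le_div_of_nonneg_right hα ha.le
  have h3 := neg_sq_div_le_of_abs_le hp h2 k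
  have h4 : a * z ^ 2 / 2 - k * z + H * k ^ 2 / 2 + α * z + β * k =
      (a / 2 * (z - k / a) ^ 2 + α * (z - k / a)) +
      ((H - 1 / a) / 2 * k ^ 2 + (β + α / a) * k) := by
    field_simp; ring
  rw [h4]
  linarith

/-- A parabola whose curvature exceeds that of the chain with edges of extent `⌊t / x⌋ * x` moves
at least as fast as that chain. -/
theorem exists_parabola_le_peeled (a b c : ℝ) (s : ℕ) (ha : 0 < a)
    (hH : 1 < a * horizontalPeriod (2 * s + 1)) :
    ∃ K : ℝ, ∀ (m : ℕ) (x y : ℝ), (x, y) ∈ hull (peel^[m] (gridPointsAbove (parabola a b c))) →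
      parabola a b c x + m / (2 * s + 1) - K ≤ y := by
  obtain ⟨e, N, V, hN, hdir, hchain⟩ := exists_chain s (fun x => (2 * s + 1) / x)
    (H := horizontalPeriod (2 * s + 1)) (by unfold horizontalPeriod; push_cast; rfl)
  set H : ℕ := horizontalPeriod (2 * s + 1) with hHdef
  obtain ⟨K, hK⟩ := exists_forall_neg_le_quadratic (A := a + 2) (B := |(V : ℝ)| + 2 * H) ha hH
  refine ⟨K + 3, fun m x y hxy => ?_⟩
  set n : ℤ := round (a * x + b) with hn
  set j : ℤ := ⌊x⌋ with hj
  set f : ℝ := x - j with hf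
  have hf0 : 0 ≤ f := by rw [hf]; linarith [Int.floor_le x]
  have hf1 : f ≤ 1 := by rw [hf]; linarith [Int.lt_floor_add_one x]
  set κ : ℝ := a * x + b - n with hκ
  have hκ1 : |κ| ≤ 1 := (abs_sub_round _).trans (by norm_num)
  -- The chain is placed with vertex (j, l) just below the tangent at x: K absorbs the quadratic
  -- form and 1 absorbs the term κ f. K does not depend on x or m.
  set l : ℤ := ⌊parabola a b c x - n * f - 1 - K⌋ with hl
  have hl1 : (l : ℝ) ≤ parabola a b c x - n * f - 1 - K := Int.floor_le _
  have hl2 : parabola a b c x - n * f - 1 - K < l + 1 := Int.lt_floor_add_one _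
  obtain ⟨Q, hQ, hQN⟩ := hchain n j l
  have hNZ : (0 : ℤ) < N := by exact_mod_cast hN
  have hs : (0 : ℤ) ≤ s := Int.natCast_nonneg s
  have hQconv : ∀ i, Q i ∈ e.region Q := e.mem_region_of_chain fun i =>
    ⟨_, Int.ediv_nonneg (by omega) (e.pos (i + 1)).le, hQ i⟩
  have hsub : gridPointsAbove (parabola a b c) ⊆ e.region Q := by
    intro p hp i
    obtain ⟨k, hk1, hk2⟩ : ∃ k : ℤ, N * (n + k) ≤ i ∧ i ≤ N * (n + k + 1) := by
      refine ⟨i / N - n, ?_, ?_⟩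
      · rw [add_sub_cancel]; exact Int.mul_ediv_self_le hNZ.ne'
      · rw [add_sub_cancel]; exact (Int.lt_mul_ediv_self_add hNZ).le.trans_eq (by ring)
    -- By convexity of the chain, line i may be replaced by its parallel through the vertex of index
    -- N(n + k), whose coordinates are explicit. This costs only the bounded terms in θ.
    refine (hQconv (N * (n + k)) i).trans ?_
    have h1 := e.det_nonneg hk1
    have h2 := e.det_nonneg hk2
    rw [hdir] at h1 h2
    obtain ⟨hX, hY⟩ := hQN k
    have hx := e.pos i
    set d := e.dir i with hd
    have hxR : (0 : ℝ) < d.1 := by exact_mod_cast hx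
    set θ : ℝ := d.2 / d.1 - n - k with hθ
    have hd2 : (d.2 : ℝ) = (θ + n + k) * d.1 := by rw [hθ]; field_simp; ring
    have hθ0 : 0 ≤ θ := by
      have h3 : (0 : ℝ) ≤ 1 * d.2 - (n + k) * d.1 := by unfold det at h1; exact_mod_cast h1
      rw [hd2] at h3
      have h4 : 0 ≤ θ * d.1 := by linarith
      exact nonneg_of_mul_nonneg_left h4 hxR
    have hθ1 : θ ≤ 1 := by
      have h3 : (0 : ℝ) ≤ d.1 * (n + k + 1) - d.2 * 1 := by unfold det at h2; exact_mod_cast h2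
      rw [hd2] at h3
      have h4 : 0 ≤ (1 - θ) * d.1 := by linarith
      linarith [nonneg_of_mul_nonneg_left h4 hxR]
    have hXR : ((Q (N * (n + k))).1 : ℝ) = j + k * H := by exact_mod_cast hX
    have hYR : 2 * ((Q (N * (n + k))).2 : ℝ) =
        2 * l + 2 * k * V + 2 * n * k * H + H * (k * (k - 1)) := by exact_mod_cast hY
    have hpR : parabola a b c p.1 ≤ p.2 := hp
    have hα : |κ - a * f - θ| ≤ a + 2 := by
      have h3 := abs_le.1 hκ1
      have h4 : a * f ≤ a := by nlinarith
      have h5 : 0 ≤ a * f := by positivity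
      rw [abs_le]
      constructor <;> linarith
    have hβ : |-(V : ℝ) + H / 2 + θ * H| ≤ |(V : ℝ)| + 2 * H := by
      have h3 := neg_abs_le (V : ℝ)
      have h4 := le_abs_self (V : ℝ)
      have h5 : (0 : ℝ) ≤ H := Nat.cast_nonneg H
      have h6 : θ * H ≤ H := by nlinarith
      have h7 : 0 ≤ θ * H := by positivity
      rw [abs_le]
      constructor <;> linarith
    have hmain := hK (p.1 - j) k _ _ hα hβ
    have hκf : κ * f ≤ 1 := by
      have h3 := abs_le.1 hκ1
      nlinarith
    have hkey : ((Q (N * (n + k))).2 : ℝ) + (θ + n + k) * (p.1 - (Q (N * (n + k))).1) ≤ p.2 := by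
      refine le_trans ?_ hpR
      have hC : parabola a b c p.1 = parabola a b c x + (n + κ) * (p.1 - j - f) +
          a * (p.1 - j - f) ^ 2 / 2 := by
        have hxf : x = j + f := by rw [hf]; ring
        have hnk : n + κ = a * x + b := by rw [hκ]; ring
        rw [hnk]
        unfold parabola
        rw [hxf]
        ring
      rw [hC, hXR]
      have : 0 ≤ a * f ^ 2 := by positivity
      linarith
    have hfin : (d.1 : ℝ) * (Q (N * (n + k))).2 - d.2 * (Q (N * (n + k))).1 ≤
        d.1 * p.2 - d.2 * p.1 := by
      rw [hd2]
      have := mul_le_mul_of_nonneg_left hkey hxR.le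
      linarith
    unfold det
    exact_mod_cast hfin
  set T : ℕ := 2 * s + 1 with hT
  have hTnat : (2 * (s : ℤ) + 1).toNat = T := by omega
  have hT0 : (0 : ℝ) < T := by exact_mod_cast Nat.succ_pos _
  -- Rounding m down to whole periods puts the chain back in its initial shape, raised by `m / T`.
  have hle : m / T * T ≤ m := Nat.div_mul_le_self m T
  have hpeel : peel^[m] (gridPointsAbove (parabola a b c)) ⊆
      e.region (e.vertex s Q (m / T * T)) :=
    ((peel_iterate_antitone _ hle).trans (peel_iterate_mono _ hsub)).trans
      (e.peel_iterate_region_subset hs hQ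
        (fun i => Int.ediv_mul_le _ (e.pos i).ne') _)
  have hlow := le_of_mem_hull (d := e.dir (N * n)) (fun p hp => hpeel hp (N * n)) hxy
  have hv : e.vertex s Q (m / T * T) (N * n) = (j, l + ((m / T : ℕ) : ℤ)) := by
    have h1 := hQN 0
    simp only [add_zero, zero_mul, mul_zero] at h1
    rw [← hTnat, e.vertex_mul_period Q hs]
    ext
    · simp [h1.1]
    · simp only [Prod.snd_add]
      omega
  rw [hv, hdir] at hlow
  simp only [det] at hlow
  simp only [Int.cast_sub, Int.cast_mul, Int.cast_add, Int.cast_natCast, Int.cast_one] at hlow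
  have hdiv : (m : ℝ) / T ≤ (m / T : ℕ) + 1 := by
    rw [div_le_iff₀ hT0]
    have := (Nat.lt_div_mul_add (a := m) (b := T) (by omega)).le
    have h2 : (m : ℝ) ≤ (m / T : ℕ) * T + T := by exact_mod_cast this
    linarith
  have hTR : (2 * (s : ℝ) + 1) = T := by rw [hT]; push_cast; ring
  rw [hTR]
  have hnx : (n : ℝ) * x = n * j + n * f := by rw [hf]; ring
  linarith

/-- The quadratic estimate behind the comparison of a flat parabola with a chain. -/
theorem exists_forall_exists_neg_le {a H : ℝ} (V : ℝ) (hH : 0 < H) (h : a * H < 1) :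
    ∃ K, ∀ z κ : ℝ, |κ| ≤ 1 → ∃ k : ℤ,
      -K ≤ k * z + k * V - H * k ^ 2 / 2 - H * k / 2 - κ * z - a * z ^ 2 / 2 := by
  have hp : 0 < 1 / H - a := by rw [sub_pos, lt_div_iff₀ hH]; exact h
  -- With k = ⌊z / H⌋, the term k z - H k² / 2 is z² / (2H) up to a bounded error, which beats a z²
  -- / 2 since a < 1/H.
  refine ⟨(|V| / H + 3 / 2) ^ 2 / (2 * (1 / H - a)) + |V| + H, fun z κ hκ => ⟨⌊z / H⌋, ?_⟩⟩
  have hk1 : (⌊z / H⌋ : ℝ) * H ≤ z := by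
    rw [← le_div_iff₀ hH]; exact Int.floor_le _
  have hk2 : z ≤ ⌊z / H⌋ * H + H := by
    have := (Int.lt_floor_add_one (z / H)).le
    rw [div_le_iff₀ hH] at this
    linarith
  generalize (⌊z / H⌋ : ℝ) = k at *
  have hβ : |V / H - 1 / 2 - κ| ≤ |V| / H + 3 / 2 := by
    have h1 : |V / H| = |V| / H := by rw [abs_div, abs_of_pos hH]
    have h2 := abs_le.1 h1.le
    have h3 := abs_le.1 hκ
    rw [abs_le]
    constructor <;> linarith
  have hquad := neg_sq_div_le_of_abs_le hp hβ z
  obtain ⟨r, rfl⟩ : ∃ r, z = k * H + r := ⟨z - k * H, by ring⟩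
  have h1 : r / H ≤ 1 := (div_le_one hH).2 (by linarith)
  have h2 : 0 ≤ r / H := div_nonneg (by linarith) hH.le
  have h3 : r * (r / H) ≤ H :=
    (mul_le_of_le_one_right (by linarith) h1).trans (by linarith)
  have h4 : r / H * V ≤ |V| :=
    (mul_le_mul_of_nonneg_left (le_abs_self V) h2).trans (mul_le_of_le_one_left (abs_nonneg V) h1)
  have hid : k * (k * H + r) + k * V - H * k ^ 2 / 2 - H * k / 2 - κ * (k * H + r)
        - a * (k * H + r) ^ 2 / 2 =
      ((1 / H - a) / 2 * (k * H + r) ^ 2 + (V / H - 1 / 2 - κ) * (k * H + r)) - r / H * V + r / 2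
        - r * (r / H) / 2 := by
    field_simp
    ring
  rw [hid]
  linarith

/-- A parabola whose curvature is below that of the chain with edges of extent
`⌊(t - 1) / x⌋ * x` moves at most as fast as that chain. -/
theorem exists_mem_peeled_le_parabola (a b c : ℝ) {s : ℕ} (hs1 : 1 ≤ s)
    (hH : a * horizontalPeriod (2 * s) < 1) (hH1 : 1 ≤ horizontalPeriod (2 * s))
    (hH2 : (horizontalPeriod (2 * s) : ℤ) =
      ∑ p ∈ primitiveVectors (2 * s + 1), 2 * (s : ℤ) / p.1 * p.1) :
    ∃ K : ℝ, ∀ (m : ℕ) (j : ℤ), ∃ v : ℤ, (j, v) ∈ peel^[m] (gridPointsAbove (parabola a b c)) ∧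
      (v : ℝ) ≤ parabola a b c j + m / (2 * s + 1) + K := by
  obtain ⟨e, N, V, hN, hdir, hchain⟩ := exists_chain s (fun x => 2 * s / x) hH2
  set H : ℕ := horizontalPeriod (2 * s) with hHdef
  have hH0 : (0 : ℝ) < H := by exact_mod_cast hH1
  obtain ⟨K, hK⟩ := exists_forall_exists_neg_le (V : ℝ) hH0 hH
  refine ⟨K + 2, fun m j => ?_⟩
  set n : ℤ := round (a * j + b) with hn
  set κ : ℝ := a * j + b - n with hκ
  have hκ1 : |κ| ≤ 1 := (abs_sub_round _).trans (by norm_num)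
  set l : ℤ := ⌈parabola a b c j + K⌉ with hl
  have hl1 : parabola a b c j + K ≤ l := Int.le_ceil _
  have hl2 : (l : ℝ) < parabola a b c j + K + 1 := Int.ceil_lt_add_one _
  obtain ⟨Q, hQ, hQN⟩ := hchain n j l
  have hs : (0 : ℤ) ≤ s := Int.natCast_nonneg s
  have hW : ∀ i, 0 ≤ 2 * (s : ℤ) / (e.dir i).1 := fun i =>
    Int.ediv_nonneg (by omega) (e.pos i).le
  have hsub : e.region Q ⊆ gridPointsAbove (parabola a b c) := by
    intro p hp'
    show parabola a b c p.1 ≤ p.2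
    set z : ℝ := p.1 - j with hz
    -- The lines of integer slope alone already keep the region above the parabola.
    obtain ⟨k, hquad⟩ := hK z κ hκ1
    have h := hp' (N * (n + k))
    obtain ⟨hX, hY⟩ := hQN k
    rw [hdir] at h
    have hXR : ((Q (N * (n + k))).1 : ℝ) = j + k * H := by exact_mod_cast hX
    have hYR : 2 * ((Q (N * (n + k))).2 : ℝ) =
        2 * l + 2 * k * V + 2 * n * k * H + H * (k * (k - 1)) := by exact_mod_cast hY
    have hR : (1 : ℝ) * (Q (N * (n + k))).2 - (n + k) * (Q (N * (n + k))).1 ≤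
        1 * p.2 - (n + k) * p.1 := by unfold det at h; exact_mod_cast h
    rw [hXR] at hR
    have hC : parabola a b c p.1 = parabola a b c j + (n + κ) * z + a * z ^ 2 / 2 := by
      have hpj : (p.1 : ℝ) = j + z := by rw [hz]; ring
      have hnk : n + κ = a * j + b := by rw [hκ]; ring
      rw [hnk, hpj]
      unfold parabola
      ring
    have hpz : (p.1 : ℝ) = j + z := by rw [hz]; ring
    rw [hpz] at hR
    rw [hC]
    linarith
  set T : ℕ := 2 * s + 1 with hT
  have hTnat : (2 * (s : ℤ) + 1).toNat = T := by omega
  have hT0 : (0 : ℝ) < T := by exact_mod_cast Nat.succ_pos _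
  -- Here m is rounded up: peeling more only shrinks the set, and the extra period costs a bounded
  -- height.
  set k : ℕ := m / T + 1 with hk
  have hle : m ≤ k * T := by
    have := (Nat.lt_div_mul_add (a := m) (b := T) (by omega)).le
    rw [hk, Nat.add_mul, one_mul]
    exact this
  have hunb : ∀ u : ℤ, ∃ k : ℤ, u < j + k * (H : ℤ) := fun u => by
    refine ⟨|u - j| + 1, ?_⟩
    have h1 := le_abs_self (u - j)
    have h2 := abs_nonneg (u - j)
    have h3 : (1 : ℤ) ≤ H := by exact_mod_cast hH1
    nlinarith
  have hunb' : ∀ u : ℤ, ∃ k : ℤ, j + k * (H : ℤ) < u := fun u => by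
    refine ⟨-(|u - j| + 1), ?_⟩
    have h1 := neg_abs_le (u - j)
    have h2 := abs_nonneg (u - j)
    have h3 : (1 : ℤ) ≤ H := by exact_mod_cast hH1
    nlinarith
  have hpeel : e.region (e.vertex s Q (k * T)) ⊆ peel^[m] (gridPointsAbove (parabola a b c)) := by
    refine ((e.region_subset_peel_iterate hs (w := fun i => 2 * s / (e.dir i).1) hQ (fun i => ?_) (fun u => ?_) (fun u => ?_) _).trans
      (peel_iterate_mono _ hsub)).trans (peel_iterate_antitone _ hle)
    · exact Int.lt_ediv_add_one_mul_self _ (e.pos i)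
    · obtain ⟨k, hk⟩ := hunb u
      exact ⟨_, ((hQN k).1).symm ▸ hk⟩
    · obtain ⟨k, hk⟩ := hunb' u
      exact ⟨_, ((hQN k).1).symm ▸ hk⟩
  have hv : ∀ i, e.vertex s Q (k * T) i = Q i + (0, (k : ℤ)) := fun i => by
    rw [← hTnat, e.vertex_mul_period Q hs]
  have hmem := e.mem_region_of_chain (q := e.vertex s Q (k * T))
    (fun i => ⟨_, hW (i + 1), by rw [hv, hv, hQ]; abel⟩) (N * n)
  have hpt : e.vertex s Q (k * T) (N * n) = (j, l + (k : ℤ)) := by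
    have h1 := hQN 0
    simp only [add_zero, zero_mul, mul_zero] at h1
    rw [hv]
    ext
    · simp [h1.1]
    · simp only [Prod.snd_add]
      omega
  rw [hpt] at hmem
  refine ⟨l + k, hpeel hmem, ?_⟩
  have hdiv : ((m / T : ℕ) : ℝ) ≤ m / T := Nat.cast_div_le
  have hTR : (2 * (s : ℝ) + 1) = T := by rw [hT]; push_cast; ring
  have hkR : (k : ℝ) = (m / T : ℕ) + 1 := by rw [hk]; exact Nat.cast_succ _
  rw [hTR, Int.cast_add, Int.cast_natCast, hkR]
  linarith

/-! ### The speed bound 1, and passage to real abscissas -/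

/-- In each column, at most one grid point is removed at each step. -/
theorem vertical_ray_subset_peel_iterate {U : Set (ℤ × ℤ)} {j l : ℤ}
    (h : ∀ v, l ≤ v → (j, v) ∈ U) (m : ℕ) : ∀ v, l + m ≤ v → (j, v) ∈ peel^[m] U := by
  induction m with
  | zero => intro v hv; exact h v (by simpa using hv)
  | succ m ih =>
    intro v hv
    push_cast at hv
    rw [Function.iterate_succ_apply']
    refine mem_peel_of_openSegment (ih v (by omega)) (gridToPlane_mem_hull (ih (v - 1) (by omega)))
      (gridToPlane_mem_hull (ih (v + 1) (by omega)))
      ⟨1 / 2, 1 / 2, by norm_num, by norm_num, by norm_num, ?_⟩ ?_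
    · ext
      · simp only [gridToPlane, Prod.fst_add, Prod.smul_fst, smul_eq_mul]; ring
      · simp only [gridToPlane, Prod.snd_add, Prod.smul_snd, smul_eq_mul]; push_cast; ring
    · intro heq
      have := congrArg Prod.snd heq
      simp only [gridToPlane] at this
      push_cast at this
      linarith

theorem exists_mem_peeled_le (C : ℝ → ℝ) (m : ℕ) (j : ℤ) :
    ∃ v : ℤ, (j, v) ∈ peel^[m] (gridPointsAbove C) ∧ (v : ℝ) ≤ C j + m + 1 := by
  refine ⟨⌈C j⌉ + m, vertical_ray_subset_peel_iterate (l := ⌈C j⌉) (fun v hv => ?_) m _ le_rfl, ?_⟩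
  · exact Int.ceil_le.1 hv
  · have := Int.ceil_lt_add_one (C j)
    push_cast
    linarith

/-- Bounds for a peeled parabola at integer abscissas extend to all abscissas. -/
theorem exists_mem_hull_le_parabola {a b c γ : ℝ} {U : Set (ℤ × ℤ)} (ha : 0 < a)
    (h : ∀ j : ℤ, ∃ v : ℤ, (j, v) ∈ U ∧ (v : ℝ) ≤ parabola a b c j + γ) (x : ℝ) :
    ∃ y, (x, y) ∈ hull U ∧ y ≤ parabola a b c x + (γ + a) := by
  obtain ⟨v, hv, hv'⟩ := h ⌊x⌋
  obtain ⟨w, hw, hw'⟩ := h (⌊x⌋ + 1)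
  set f : ℝ := x - ⌊x⌋ with hf
  have hf0 : 0 ≤ f := by rw [hf]; linarith [Int.floor_le x]
  have hf1 : f ≤ 1 := by rw [hf]; linarith [Int.lt_floor_add_one x]
  have hmem : (1 - f) • gridToPlane (⌊x⌋, v) + f • gridToPlane (⌊x⌋ + 1, w) ∈ hull U :=
    (convex_convexHull ℝ _) (gridToPlane_mem_hull hv) (gridToPlane_mem_hull hw) (by linarith) hf0
      (by ring)
  refine ⟨(1 - f) * v + f * w, ?_, ?_⟩
  · convert hmem using 1
    ext
    · simp only [gridToPlane, Prod.fst_add, Prod.smul_fst, smul_eq_mul]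
      push_cast
      rw [hf]; ring
    · simp only [gridToPlane, Prod.snd_add, Prod.smul_snd, smul_eq_mul]
  · have h1 := mul_le_mul_of_nonneg_left hv' (by linarith : 0 ≤ 1 - f)
    have h2 := mul_le_mul_of_nonneg_left hw' hf0
    -- A chord over a unit interval exceeds the parabola by a f (1 - f) / 2.
    have h3 : (1 - f) * (parabola a b c ⌊x⌋ + γ) + f * (parabola a b c ((⌊x⌋ + 1 : ℤ) : ℝ) + γ) =
        parabola a b c x + γ + a * (f * (1 - f)) / 2 := by
      rw [hf]
      unfold parabola
      push_cast
      ring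
    have h4 : f * (1 - f) ≤ 1 := by nlinarith
    have h5 : a * (f * (1 - f)) ≤ a := by nlinarith
    linarith

/-! ### Monotonicity of the periods, and limits of the speeds -/

open Filter

theorem primitiveVectors_mono {t u : ℕ} (h : t ≤ u) : primitiveVectors t ⊆ primitiveVectors u := by
  intro p hp
  simp only [primitiveVectors, Finset.mem_filter, Finset.mem_product, Finset.mem_Icc] at hp ⊢
  omega

/-- This lets H_{t-1} be the period of a chain on the Farey sequence of order t: directions of
extent t get multiplicity 0. -/
theorem horizontalPeriod_eq_sum_succ (t : ℕ) :
    horizontalPeriod t = ∑ p ∈ primitiveVectors (t + 1), t / p.1 * p.1 := by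
  refine Finset.sum_subset (primitiveVectors_mono t.le_succ) fun p hp hp' => ?_
  simp only [primitiveVectors, Finset.mem_filter, Finset.mem_product, Finset.mem_Icc] at hp hp'
  rw [Nat.div_eq_of_lt, zero_mul]
  by_contra h
  exact hp' ⟨by omega, hp.2⟩

theorem horizontalPeriod_strictMono : StrictMono horizontalPeriod := by
  refine strictMono_nat_of_lt_succ fun t => ?_
  rw [horizontalPeriod_eq_sum_succ t, horizontalPeriod]
  refine Finset.sum_lt_sum (fun p _ => Nat.mul_le_mul_right _ (Nat.div_le_div_right t.le_succ))
    ⟨(t + 1, 1), ?_, ?_⟩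
  · simp [primitiveVectors]
  · rw [Nat.div_eq_of_lt t.lt_succ_self, Nat.div_self t.succ_pos]
    omega

theorem horizontalPeriod_one : horizontalPeriod 1 = 1 := by decide

theorem horizontalPeriod_pos {t : ℕ} (ht : 1 ≤ t) : 0 < horizontalPeriod t :=
  (Nat.zero_le _).trans_lt (horizontalPeriod_strictMono (Nat.lt_of_lt_of_le Nat.zero_lt_one ht))

theorem tendsto_div_add_div (t K : ℝ) :
    Tendsto (fun m : ℕ => (((m / t + K : ℝ) : EReal) / (m : EReal))) atTop
      (nhds ((1 / t : ℝ) : EReal)) := by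
  have h : Tendsto (fun m : ℕ => 1 / t + K / m) atTop (nhds (1 / t)) := by
    simpa using tendsto_const_nhds.add (tendsto_const_div_atTop_nhds_zero_nat K)
  refine Tendsto.congr' ?_ ((continuous_coe_real_ereal.tendsto _).comp h)
  filter_upwards [eventually_gt_atTop 0] with m hm
  have hm' : (m : ℝ) ≠ 0 := by exact_mod_cast hm.ne'
  rw [Function.comp_apply, ← EReal.coe_natCast, ← EReal.coe_div]
  congr 1
  field_simp

theorem le_lowerSpeed {C : ℝ → ℝ} {t K : ℝ} (h : ∀ (m : ℕ) (x y : ℝ),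
    (x, y) ∈ hull (peel^[m] (gridPointsAbove C)) → C x + m / t - K ≤ y) :
    ((1 / t : ℝ) : EReal) ≤ lowerSpeed C := by
  rw [← (tendsto_div_add_div t (-K)).liminf_eq]
  refine liminf_le_liminf (Eventually.of_forall fun m => ?_)
  refine EReal.div_le_div_right_of_nonneg (by positivity) (le_sSup ⟨m / t + -K, fun x => ?_, rfl⟩)
  refine le_sInf ?_
  rintro _ ⟨y, hy, rfl⟩
  have := h m x y hy
  exact EReal.coe_le_coe_iff.2 (by linarith)

theorem upperSpeed_le {C : ℝ → ℝ} {t K : ℝ} (h : ∀ (m : ℕ) (x : ℝ),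
    ∃ y, (x, y) ∈ hull (peel^[m] (gridPointsAbove C)) ∧ y ≤ C x + (m / t + K)) :
    upperSpeed C ≤ ((1 / t : ℝ) : EReal) := by
  rw [← (tendsto_div_add_div t K).limsup_eq]
  refine limsup_le_limsup (Eventually.of_forall fun m => ?_)
  refine EReal.div_le_div_right_of_nonneg (by positivity) (sInf_le ⟨m / t + K, fun x => ?_, rfl⟩)
  obtain ⟨y, hy, hle⟩ := h m x
  have hy' : peeledCurve C m x ≤ (y : EReal) := sInf_le ⟨y, hy, rfl⟩
  exact hy'.trans (EReal.coe_le_coe_iff.2 hle)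

theorem lowerSpeed_le_upperSpeed (C : ℝ → ℝ) : lowerSpeed C ≤ upperSpeed C := by
  refine (liminf_le_liminf (Eventually.of_forall fun m => ?_)).trans liminf_le_limsup
  refine EReal.div_le_div_right_of_nonneg (by positivity) (sSup_le ?_)
  rintro _ ⟨γ, hγ, rfl⟩
  refine le_sInf ?_
  rintro _ ⟨γ', hγ', rfl⟩
  have := EReal.coe_le_coe_iff.1 ((hγ 0).trans (hγ' 0))
  exact EReal.coe_le_coe_iff.2 (by linarith)

/-- The lower speed of a parabola of curvature greater than `1 / H_t`, for `t` odd. -/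
theorem le_lowerSpeed_parabola {a b c : ℝ} {t : ℕ} (ht : Odd t)
    (ha : 1 / (horizontalPeriod t : ℝ) < a) :
    ((1 / (t : ℝ) : ℝ) : EReal) ≤ lowerSpeed (parabola a b c) := by
  obtain ⟨s, rfl⟩ := ht
  have hH : (0 : ℝ) < horizontalPeriod (2 * s + 1) := by
    exact_mod_cast horizontalPeriod_pos (by omega)
  have ha0 : 0 < a := (by positivity : (0 : ℝ) < 1 / horizontalPeriod (2 * s + 1)).trans ha
  obtain ⟨K, hK⟩ := exists_parabola_le_peeled a b c s ha0 ((div_lt_iff₀ hH).1 ha)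
  push_cast
  exact le_lowerSpeed hK

/-- The upper speed of a parabola of curvature less than `1 / H_{t - 1}`, for `t` odd. -/
theorem upperSpeed_parabola_le {a b c : ℝ} {t : ℕ} (ht : Odd t) (ha : 0 < a)
    (hat : t = 1 ∨ a < 1 / (horizontalPeriod (t - 1) : ℝ)) :
    upperSpeed (parabola a b c) ≤ ((1 / (t : ℝ) : ℝ) : EReal) := by
  obtain ⟨s, rfl⟩ := ht
  suffices h : ∃ K : ℝ, ∀ (m : ℕ) (j : ℤ),
      ∃ v : ℤ, (j, v) ∈ peel^[m] (gridPointsAbove (parabola a b c)) ∧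
        (v : ℝ) ≤ parabola a b c j + (m / ((2 * s + 1 : ℕ) : ℝ) + K) by
    obtain ⟨K, hK⟩ := h
    refine upperSpeed_le (K := K + a) fun m x => ?_
    rw [← add_assoc (m / _ : ℝ)]
    exact exists_mem_hull_le_parabola ha (hK m) x
  -- For s = 0 the period H_0 is an empty sum, so no chain is available; a column loses at most one
  -- point per step instead.
  rcases Nat.eq_zero_or_pos s with rfl | hs
  · refine ⟨1, fun m j => ?_⟩
    obtain ⟨v, hv, hle⟩ := exists_mem_peeled_le (parabola a b c) m j
    refine ⟨v, hv, ?_⟩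
    norm_num
    linarith
  · have hat : a < 1 / (horizontalPeriod (2 * s) : ℝ) := hat.resolve_left (by omega)
    have hpos : 0 < horizontalPeriod (2 * s) := horizontalPeriod_pos (by omega)
    have hH : (0 : ℝ) < horizontalPeriod (2 * s) := by exact_mod_cast hpos
    obtain ⟨K, hK⟩ := exists_mem_peeled_le_parabola a b c hs ((lt_div_iff₀ hH).1 hat) hpos
      (by rw [horizontalPeriod_eq_sum_succ]; push_cast; rfl)
    refine ⟨K, fun m j => ?_⟩
    obtain ⟨v, hv, hle⟩ := hK m j
    refine ⟨v, hv, ?_⟩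
    push_cast
    linarith

theorem one_div_horizontalPeriod_lt {t u : ℕ} (ht : 1 ≤ t) (h : t < u) :
    1 / (horizontalPeriod u : ℝ) < 1 / (horizontalPeriod t : ℝ) :=
  one_div_lt_one_div_of_lt (by exact_mod_cast horizontalPeriod_pos ht)
    (by exact_mod_cast horizontalPeriod_strictMono h)

theorem one_div_horizontalPeriod_pos {t : ℕ} (ht : 1 ≤ t) :
    0 < 1 / (horizontalPeriod t : ℝ) :=
  one_div_pos.2 (by exact_mod_cast horizontalPeriod_pos ht)

end GridPeeling

theorem mainTheorem3 (a b c : ℝ) :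
    (1 < a → GridPeeling.HasAverageSpeed (GridPeeling.parabola a b c) 1) ∧
    (∀ t : ℕ, 2 ≤ t → Odd t →
      1 / (GridPeeling.horizontalPeriod t : ℝ) < a →
      a < 1 / (GridPeeling.horizontalPeriod (t - 1) : ℝ) →
      GridPeeling.HasAverageSpeed (GridPeeling.parabola a b c) (1 / (t : ℝ))) ∧
    (∀ t : ℕ, 2 ≤ t → Even t →
      1 / (GridPeeling.horizontalPeriod t : ℝ) < a →
      a < 1 / (GridPeeling.horizontalPeriod (t - 1) : ℝ) →
      GridPeeling.SpeedsBetween (GridPeeling.parabola a b c)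
        (1 / ((t : ℝ) + 1)) (1 / ((t : ℝ) - 1))) ∧
    (∀ t : ℕ, 1 ≤ t → Odd t →
      a = 1 / (GridPeeling.horizontalPeriod t : ℝ) →
      GridPeeling.SpeedsBetween (GridPeeling.parabola a b c)
        (1 / ((t : ℝ) + 2)) (1 / (t : ℝ))) ∧
    (∀ t : ℕ, 1 ≤ t → Even t →
      a = 1 / (GridPeeling.horizontalPeriod t : ℝ) →
      GridPeeling.SpeedsBetween (GridPeeling.parabola a b c)
        (1 / ((t : ℝ) + 1)) (1 / ((t : ℝ) - 1))) := by

  refine ⟨fun ha => ?_, fun t ht hodd h1 h2 => ?_, fun t ht heven h1 h2 => ?_,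
    fun t ht hodd h => ?_, fun t ht heven h => ?_⟩
  · have hlow := GridPeeling.le_lowerSpeed_parabola (a := a) (b := b) (c := c) odd_one
      (by rw [GridPeeling.horizontalPeriod_one]; simpa using ha)
    have hupp := GridPeeling.upperSpeed_parabola_le (a := a) (b := b) (c := c) odd_one
      (one_pos.trans ha) (Or.inl rfl)
    rw [Nat.cast_one, div_one] at hlow hupp
    have hle := GridPeeling.lowerSpeed_le_upperSpeed (GridPeeling.parabola a b c)
    exact ⟨(hle.trans hupp).antisymm hlow, hupp.antisymm (hlow.trans hle)⟩
  · have ha := (GridPeeling.one_div_horizontalPeriod_pos (by omega)).trans h1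
    have hlow := GridPeeling.le_lowerSpeed_parabola (b := b) (c := c) hodd h1
    have hupp := GridPeeling.upperSpeed_parabola_le (b := b) (c := c) hodd ha (Or.inr h2)
    have hle := GridPeeling.lowerSpeed_le_upperSpeed (GridPeeling.parabola a b c)
    exact ⟨(hle.trans hupp).antisymm hlow, hupp.antisymm (hlow.trans hle)⟩
  · have ha := (GridPeeling.one_div_horizontalPeriod_pos (by omega)).trans h1
    refine ⟨?_, GridPeeling.lowerSpeed_le_upperSpeed _, ?_⟩
    -- For even t, the odd orders t + 1 and t - 1 bound the speeds.
    · have := GridPeeling.le_lowerSpeed_parabola (b := b) (c := c) heven.add_one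
        ((GridPeeling.one_div_horizontalPeriod_lt (by omega) t.lt_succ_self).trans h1)
      rwa [Nat.cast_add_one] at this
    · have := GridPeeling.upperSpeed_parabola_le (b := b) (c := c)
        (Nat.Even.sub_odd (by omega) heven odd_one) ha ?_
      · rwa [Nat.cast_sub (by omega), Nat.cast_one] at this
      · rcases Nat.lt_or_ge 2 t with h3 | h3
        · exact Or.inr (h2.trans (GridPeeling.one_div_horizontalPeriod_lt (by omega) (by omega)))
        · exact Or.inl (by omega)
  · have ha := h ▸ GridPeeling.one_div_horizontalPeriod_pos ht
    refine ⟨?_, GridPeeling.lowerSpeed_le_upperSpeed _, ?_⟩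
    -- The lower bound needs a > 1/H strictly, so at a = 1/H_t with t odd the next usable odd order
    -- is t + 2.
    · have := GridPeeling.le_lowerSpeed_parabola (a := a) (b := b) (c := c)
        (hodd.add_even even_two)
        (h ▸ GridPeeling.one_div_horizontalPeriod_lt ht (by omega))
      rwa [Nat.cast_add, Nat.cast_two] at this
    · refine GridPeeling.upperSpeed_parabola_le hodd ha ?_
      rcases Nat.lt_or_ge 1 t with h3 | h3
      · exact Or.inr (h ▸ GridPeeling.one_div_horizontalPeriod_lt (by omega) (by omega))
      · exact Or.inl (by omega)
  · have ha := h ▸ GridPeeling.one_div_horizontalPeriod_pos ht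
    refine ⟨?_, GridPeeling.lowerSpeed_le_upperSpeed _, ?_⟩
    · have := GridPeeling.le_lowerSpeed_parabola (a := a) (b := b) (c := c) heven.add_one
        (h ▸ GridPeeling.one_div_horizontalPeriod_lt ht t.lt_succ_self)
      rwa [Nat.cast_add_one] at this
    · have := GridPeeling.upperSpeed_parabola_le (a := a) (b := b) (c := c)
        (Nat.Even.sub_odd ht heven odd_one) ha ?_
      · rwa [Nat.cast_sub ht, Nat.cast_one] at this
      · rcases Nat.lt_or_ge 2 t with h3 | h3
        · exact Or.inr (h ▸ GridPeeling.one_div_horizontalPeriod_lt (by omega) (by omega))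
        · obtain ⟨r, rfl⟩ := heven
          exact Or.inl (by omega)
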